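/- **Objects.** A *proto-object* is the atom $\square$, or a finite (possibly empty) list of proto-objects enclosed in $(\,)$ (sequence), in $[\,]$ (cyclic sequence) or in $\{\,\}$ (multiset). A *profiled object* is a finite concatenation of proto-objects together with a set-partition (its *profile*) of the set of its atoms; these are taken up to circular shifts inside $[\,]$, permutations inside $\{\,\}$, at every depth. The profile of a concatenation is the union of the profiles. The diagonal $\delta_k a=a\cdots a$ ($k\ge 1$ copies) has as profile the sets $P^1\cup\dots\cup P^k$, where $P$ runs over the parts of the profile of $a$ and $P^i$ is its copy in the $i$-th copy of $a$. **Classes.** The constructible classes are built by the following constructions, with the indicated elements: * $\mathcal E$: the object $()$; $\mathcal Z$: the object $\square$ with profile $\{\{\square\}\}$; the sum (union) $\mathcal A+\mathcal B$; * $\mathcal A\times\mathcal B$: $(ab)$ with $a\in\mathcal A$, $b\in\mathcal B$; $\Delta_k(\mathcal A)$: $\delta_k a$ with $a\in\mathcal A$; * $\mathrm{Seq}(\mathcal A)$: $(a_1\cdots a_l)$ with $l\ge 0$, $a_i\in\mathcal A$; $\mathrm{MSet}(\mathcal A)$: $\{\delta_{k_1}a_1\cdots\delta_{k_l}a_l\}$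 with $l\ge0$, $k_i\ge 1$, $a_i\in\mathcal A$; $\mathrm{Cyc}(\mathcal A)$: $[\delta_k(a_1\cdots a_l)]$ with $k,l\ge1$, $a_i\in\mathcal A$. Recursive definitions by a system of equations $\mathcal T_i=\mathcal E_i$, where each $\mathcal E_i$ is an expression in the $\mathcal T_j$, are also allowed. **Generating functions.** $F_{\mathcal A}$ is the formal power series in $s_1,s_2,\dots$ with coefficients in $[0,\infty]$ (with $0\cdot\infty=0$) given by $F_{\mathcal E}=1$, $F_{\mathcal Z}=s_1$, $F_{\mathcal A+\mathcal B}=F_{\mathcal A}+F_{\mathcal B}$, $F_{\mathcal A\times\mathcal B}=F_{\mathcal A}F_{\mathcal B}$, $F_{\Delta_k(\mathcal A)}(s_1,s_2,\dots)=F_{\mathcal A}(s_k,s_{2k},\dots)$, and $$F_{\mathrm{Seq}(\mathcal A)}=\frac1{1-F_{\mathcal A}},\qquad F_{\mathrm{MSet}(\mathcal A)}=\exp\Big(\sum_{k\ge1}\tfrac1kF_{\Delta_k(\mathcal A)}\Big),\qquad F_{\mathrm{Cyc}(\mathcal A)}=-\sum_{k\ge1}\tfrac{\varphi(k)}k\ln\big(1-F_{\Delta_k(\mathcal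 A)}\big),$$ the functions $1/(1-F)$, $\exp F$, $-\ln(1-F)$ being understood as their expansions in powers of $F$. For a recursive system, $(F_{\mathcal T_i})_i$ is the least solution of the corresponding equations, i.e. the coefficientwise limit of the iterates starting from $0$. **Samplers.** Let $s=(s_1,s_2,\dots)$ be nonnegative reals, and write $\mathcal A[j]=F_{\mathcal A}(s_j,s_{2j},\dots)$. The samplers $\Gamma\mathcal A_s$ are the following random programs (all draws are independent). * $\Gamma\mathcal E_s$ returns $()$ and $\Gamma\mathcal Z_s$ returns $\square$. * $\Gamma(\mathcal A+\mathcal B)_s$ runs $\Gamma\mathcal A_s$ with probability $F_{\mathcal A}(s)/F_{\mathcal A+\mathcal B}(s)$, and $\Gamma\mathcal B_s$ otherwise. * $\Gamma(\mathcal A\times\mathcal B)_s$ draws $a$ from $\Gamma\mathcal A_s$ and $b$ from $\Gamma\mathcal B_s$, and returns $(ab)$. * $\Gamma\Delta_k(\mathcal A)_s$ draws $a$ from $\Gamma\mathcal A_{(s_k,s_{2k},\dots)}$ and returns $\delta_ka$. * $\Gamma\mathrm{Seq}(\mathcal A)_s$ draws $k\ge0$ with probability $F_{\mathcal A}(s)^k(1-F_{\mathcal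 A}(s))$, and returns $(a_1\cdots a_k)$ with $a_1,\dots,a_k$ drawn from $\Gamma\mathcal A_s$. * $\Gamma\mathrm{MSet}(\mathcal A)_s$ draws $k\ge1$ from the law of a variable $K$ with $\mathbb P(K\le k)=\prod_{j>k}\exp\big(-\tfrac1j\mathcal A[j]\big)$. If $k=1$, it draws $q$ from the Poisson law of parameter $F_{\mathcal A}(s)$ and returns $\{a_1\cdots a_q\}$ with the $a_i$ drawn from $\Gamma\mathcal A_s$. If $k>1$, it draws, for each $j<k$, $q_j$ from the Poisson law of parameter $\tfrac1j\mathcal A[j]$, and $q_k$ from the Poisson law of parameter $\tfrac1k\mathcal A[k]$ conditioned to be positive; then it draws $q_j$ objects from $\Gamma\Delta_j(\mathcal A)_s$ for $j=1,\dots,k$, and returns their concatenation enclosed in $\{\,\}$. * $\Gamma\mathrm{Cyc}(\mathcal A)_s$ draws $k\ge1$ with probability $-\frac1{F_{\mathrm{Cyc}(\mathcal A)}(s)}\frac{\varphi(k)}k\ln(1-\mathcal A[k])$, then $l\ge1$ with probability $-\frac{\mathcal A[k]^l}{l}\frac1{\ln(1-\mathcal A[k])}$, then $a_1,\dots,a_l$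 from $\Gamma\mathcal A_{(s_k,s_{2k},\dots)}$, and returns $[\delta_k(a_1\cdots a_l)]$. * $\Gamma(\mathcal T_i)_s$ runs $\Gamma(\mathcal E_i)_s$. **Proposition 3.1.** Let $\mathcal A$ be a constructible class and let $s_1,s_2,\dots\ge0$ be such that $0<F_{\mathcal A}(s_1,s_2,\dots)<\infty$. Then $\Gamma\mathcal A_{(s_1,s_2,\dots)}$ is a valid Boltzmann sampler for profiled objects: it almost surely terminates, every possible output is an object of $\mathcal A$, and for every finitely supported family $(n_i)_{i\ge1}$ of nonnegative integers, the probability that the profile of its output has exactly $n_i$ parts of size $i$ for every $i\ge1$ is $$\frac{[s_1^{n_1}s_2^{n_2}\cdots]F_{\mathcal A}\cdot s_1^{n_1}s_2^{n_2}\cdots}{F_{\mathcal A}(s_1,s_2,\dots)}.$$ -/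

import Mathlib

open Filter Topology
open scoped ENNReal NNReal Nat

/-! ### Objects -/

/-- A `B`-colored proto-object, i.e. a word over the alphabet made of the atom and of three kinds of
brackets, together with a color in `B` for each occurrence of the atom. A well-bracketed word is
given by its parse tree; the empty lists are the words `()`, `[]` and `{}`. -/
inductive Proto (B : Type) : Type
  /-- the atom, with its color -/
  | atom (b : B) : Proto B
  /-- a sequence `(A₁ … Aₖ)` -/
  | paren (l : List (Proto B)) : Proto B
  /-- a cyclic sequence `[A₁ … Aₖ]` -/
  | bracket (l : List (Proto B)) : Proto B
  /-- a multiset `{A₁ … Aₖ}` -/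
  | brace (l : List (Proto B)) : Proto B

namespace Proto

mutual
/-- The colors of the atoms of a proto-object, from left to right. -/
def atoms {B : Type} : Proto B → List B
  | atom b => [b]
  | paren l => atomsWord l
  | bracket l => atomsWord l
  | brace l => atomsWord l
/-- The colors of the atoms of a concatenation of proto-objects, from left to right. -/
def atomsWord {B : Type} : List (Proto B) → List B
  | [] => []
  | a :: l => atoms a ++ atomsWord l
end

mutual
/-- Change of colors in a proto-object. -/
def recolor {B C : Type} (g : B → C) : Proto B → Proto C
  | atom b => atom (g b)
  | paren l => paren (recolorWord g l)
  | bracket l => bracket (recolorWord g l)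
  | brace l => brace (recolorWord g l)
/-- Change of colors in a concatenation of proto-objects. -/
def recolorWord {B C : Type} (g : B → C) : List (Proto B) → List (Proto C)
  | [] => []
  | a :: l => recolor g a :: recolorWord g l
end

/-- The equivalence of `B`-colored proto-objects: sequences are compared term by term, cyclic
sequences up to a circular shift, multisets up to a permutation. -/
inductive Equivalent {B : Type} : Proto B → Proto B → Prop
  | atom (b : B) : Equivalent (.atom b) (.atom b)
  | paren {l l' : List (Proto B)} :
      List.Forall₂ Equivalent l l' → Equivalent (.paren l) (.paren l')
  | bracket {l m l' : List (Proto B)} :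
      List.Forall₂ Equivalent l m → List.IsRotated m l' → Equivalent (.bracket l) (.bracket l')
  | brace {l m l' : List (Proto B)} :
      List.Forall₂ Equivalent l m → List.Perm m l' → Equivalent (.brace l) (.brace l')

theorem atomsWord_eq_flatMap {B : Type} (l : List (Proto B)) : atomsWord l = l.flatMap atoms := by
  induction l with
  | nil => rfl
  | cons a l ih => simp [atomsWord, ih]

theorem atomsWord_perm {B : Type} {l l' : List (Proto B)} (h : l.Perm l') :
    (atomsWord l).Perm (atomsWord l') := by
  rw [atomsWord_eq_flatMap, atomsWord_eq_flatMap]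
  exact h.flatMap_right _

theorem Equivalent.atoms_perm {B : Type} {a a' : Proto B} (h : Equivalent a a') :
    (atoms a).Perm (atoms a') :=
  Equivalent.rec (motive_1 := fun a a' _ => (atoms a).Perm (atoms a'))
    (motive_2 := fun l l' _ => (atomsWord l).Perm (atomsWord l'))
    (fun _ => List.Perm.refl _)
    (fun _ ih => ih)
    (fun _ h ih => ih.trans (atomsWord_perm h.perm))
    (fun _ h ih => ih.trans (atomsWord_perm h))
    (List.Perm.refl _)
    (fun _ _ ih₁ ih₂ => List.Perm.append ih₁ ih₂) h

theorem atomsWord_perm_of_equivalent {B : Type} {l l' : List (Proto B)}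
    (h : List.Forall₂ Equivalent l l') : (atomsWord l).Perm (atomsWord l') := by
  induction h with
  | nil => exact List.Perm.refl _
  | cons h _ ih => exact List.Perm.append h.atoms_perm ih

mutual
theorem atoms_recolor {B C : Type} (g : B → C) :
    ∀ a : Proto B, atoms (recolor g a) = (atoms a).map g
  | .atom b => by simp [recolor, atoms]
  | .paren l => by simpa [recolor, atoms] using atomsWord_recolorWord g l
  | .bracket l => by simpa [recolor, atoms] using atomsWord_recolorWord g l
  | .brace l => by simpa [recolor, atoms] using atomsWord_recolorWord g l
theorem atomsWord_recolorWord {B C : Type} (g : B → C) :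
    ∀ l : List (Proto B), atomsWord (recolorWord g l) = (atomsWord l).map g
  | [] => by simp [recolorWord, atomsWord]
  | a :: l => by
      simp [recolorWord, atomsWord, atoms_recolor g a, atomsWord_recolorWord g l]
end

end Proto

/-- A word (a concatenation of proto-objects) with a set-partition of its atoms. The partition is
given by the labels of the atoms: two atoms are in the same part when they have the same label.
Words that differ by the names of the labels carry the same partition; they are identified in
`ProfiledObject` below. -/
abbrev ProfiledWord : Type := List (Proto ℕ)

namespace ProfiledWord

/-- The number of parts of size `i` of the partition. -/
def partCount (w : ProfiledWord) (i : ℕ+) : ℕ :=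
  ((Proto.atomsWord w).toFinset.filter fun b => (Proto.atomsWord w).count b = i).card

/-- Concatenation; the partition is the disjoint union of the two partitions. -/
def concat (u v : ProfiledWord) : ProfiledWord :=
  Proto.recolorWord (fun b => 2 * b) u ++ Proto.recolorWord (fun b => 2 * b + 1) v

/-- Concatenation of a list of words, from left to right. -/
def concatList (l : List ProfiledWord) : ProfiledWord := l.foldl concat []

/-- The diagonal `δₖ w = w … w` (`k` times); the copies of a part of `w` are merged into one part. -/
def diag (k : ℕ+) (w : ProfiledWord) : ProfiledWord := (List.replicate (k : ℕ) w).flatten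

/-- Two words with partitioned atoms represent the same profiled object: after a renaming of the
labels of the parts, the words are equivalent as colored words. -/
def Rel (w w' : ProfiledWord) : Prop :=
  ∃ g : Equiv.Perm ℕ, List.Forall₂ Proto.Equivalent (Proto.recolorWord g w) w'

theorem partCount_eq_of_rel {w w' : ProfiledWord} (h : Rel w w') :
    w.partCount = w'.partCount := by
  obtain ⟨g, hg⟩ := h
  have hp := Proto.atomsWord_perm_of_equivalent hg
  rw [Proto.atomsWord_recolorWord] at hp
  funext i
  unfold partCount
  have hfin : ((Proto.atomsWord w').toFinset.filter fun b => (Proto.atomsWord w').count b = i) =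
      ((Proto.atomsWord w).toFinset.filter fun b => (Proto.atomsWord w).count b = i).map
        g.toEmbedding := by
    ext b
    obtain ⟨c, rfl⟩ := g.surjective b
    have h1 : (Proto.atomsWord w').count (g c) = (Proto.atomsWord w).count c := by
      rw [← hp.count_eq]
      exact List.count_map_of_injective _ _ g.injective _
    have h2 : g c ∈ Proto.atomsWord w' ↔ c ∈ Proto.atomsWord w := by
      rw [← hp.mem_iff]
      simp
    simp [h1, h2]
  rw [hfin, Finset.card_map]

end ProfiledWord

/-- A profiled object: an object together with a set-partition (its profile) of its atoms. -/
def ProfiledObject : Type := Quot ProfiledWord.Rel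

/-- The profiled object represented by a word. -/
def ProfiledWord.toObject (w : ProfiledWord) : ProfiledObject := Quot.mk _ w

/-- The number of parts of size `i` of the profile. -/
def ProfiledObject.partCount (o : ProfiledObject) : ℕ+ → ℕ :=
  Quot.lift ProfiledWord.partCount (fun _ _ h => ProfiledWord.partCount_eq_of_rel h) o

/-! ### Constructible classes -/

/-- The expressions that describe the constructible classes. The variables `var i` stand for
classes that are defined recursively by a system `E : ι → Spec ι` of equations `Tᵢ = E i`. -/
inductive Spec (ι : Type*)
  | neutral : Spec ι
  | atom : Spec ι
  | var (i : ι) : Spec ι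
  | sum (A B : Spec ι) : Spec ι
  | prod (A B : Spec ι) : Spec ι
  | diag (k : ℕ+) (A : Spec ι) : Spec ι
  | seq (A : Spec ι) : Spec ι
  | mset (A : Spec ι) : Spec ι
  | cyc (A : Spec ι) : Spec ι

/-- The words that represent the elements of the class described by an expression, the variables
being defined by the system `E`. Multiplicities of elements are not recorded. -/
inductive Spec.Mem {ι : Type*} (E : ι → Spec ι) : Spec ι → ProfiledWord → Prop
  | neutral : Mem E .neutral [.paren []]
  | atom : Mem E .atom [.atom 0]
  | var {i : ι} {w : ProfiledWord} : Mem E (E i) w → Mem E (.var i) w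
  | sum_left {A B : Spec ι} {w : ProfiledWord} : Mem E A w → Mem E (.sum A B) w
  | sum_right {A B : Spec ι} {w : ProfiledWord} : Mem E B w → Mem E (.sum A B) w
  | prod {A B : Spec ι} {u v : ProfiledWord} :
      Mem E A u → Mem E B v → Mem E (.prod A B) [.paren (u.concat v)]
  | diag {k : ℕ+} {A : Spec ι} {w : ProfiledWord} : Mem E A w → Mem E (.diag k A) (w.diag k)
  | seq {A : Spec ι} {l : List ProfiledWord} :
      (∀ w ∈ l, Mem E A w) → Mem E (.seq A) [.paren (ProfiledWord.concatList l)]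
  | mset {A : Spec ι} {l : List (ℕ+ × ProfiledWord)} :
      (∀ p ∈ l, Mem E A p.2) →
      Mem E (.mset A) [.brace (ProfiledWord.concatList (l.map fun p => p.2.diag p.1))]
  | cyc {A : Spec ι} {k : ℕ+} {l : List ProfiledWord} :
      l ≠ [] → (∀ w ∈ l, Mem E A w) →
      Mem E (.cyc A) [.bracket ((ProfiledWord.concatList l).diag k)]

/-- The set of the profiled objects of the class described by the expression `A`. -/
def Spec.objects {ι : Type*} (E : ι → Spec ι) (A : Spec ι) : Set ProfiledObject :=
  {o | ∃ w : ProfiledWord, Spec.Mem E A w ∧ w.toObject = o}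

noncomputable section

/-! ### Generating functions -/

/-- Formal power series in the variables `s₁, s₂, …`. Coefficients in `[0, ∞]` are used so that all
the infinite sums below, and the least solutions of systems of equations, are defined. -/
abbrev ProfileSeries : Type := MvPowerSeries ℕ+ ℝ≥0∞

namespace ProfileSeries

/-- The sum of a family of series, coefficient by coefficient. -/
def sum {α : Type} (f : α → ProfileSeries) : ProfileSeries :=
  fun n => ∑' a, MvPowerSeries.coeff n (f a)

/-- The series `F(s_k, s_{2k}, …)`. -/
def diag (k : ℕ+) (F : ProfileSeries) : ProfileSeries :=
  open Classical in
  fun n => ∑' m : ℕ+ →₀ ℕ, if m.mapDomain (fun i => k * i) = n then MvPowerSeries.coeff m F else 0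

/-- The series `1 / (1 - F) = ∑_{l ≥ 0} F ^ l`. -/
def geom (F : ProfileSeries) : ProfileSeries := sum fun l : ℕ => F ^ l

/-- The series `exp F = ∑_{l ≥ 0} F ^ l / l!`. -/
def exp (F : ProfileSeries) : ProfileSeries := sum fun l : ℕ => (l ! : ℝ≥0∞)⁻¹ • F ^ l

/-- The series `- ln (1 - F) = ∑_{l ≥ 1} F ^ l / l`. -/
def negLog (F : ProfileSeries) : ProfileSeries := sum fun l : ℕ+ => (l : ℝ≥0∞)⁻¹ • F ^ (l : ℕ)

/-- The monomial `s₁^{n₁} s₂^{n₂} …` at a point `s`. -/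
def monomialValue (s : ℕ+ → ℝ≥0) (n : ℕ+ →₀ ℕ) : ℝ≥0∞ := n.prod fun i m => (s i : ℝ≥0∞) ^ m

/-- The value `F(s₁, s₂, …)`, which is `∞` when the series diverges. -/
def eval (s : ℕ+ → ℝ≥0) (F : ProfileSeries) : ℝ≥0∞ :=
  ∑' n : ℕ+ →₀ ℕ, MvPowerSeries.coeff n F * monomialValue s n

end ProfileSeries

/-- The generating function of the class described by an expression, when the generating functions
of the variables are given. -/
def Spec.genFunOf {ι : Type*} (T : ι → ProfileSeries) : Spec ι → ProfileSeries
  | .neutral => 1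
  | .atom => MvPowerSeries.X 1
  | .var i => T i
  | .sum A B => A.genFunOf T + B.genFunOf T
  | .prod A B => A.genFunOf T * B.genFunOf T
  | .diag k A => (A.genFunOf T).diag k
  | .seq A => (A.genFunOf T).geom
  | .mset A => ProfileSeries.exp
      (ProfileSeries.sum fun k : ℕ+ => (k : ℝ≥0∞)⁻¹ • (A.genFunOf T).diag k)
  | .cyc A => ProfileSeries.sum fun k : ℕ+ =>
      ((φ (k : ℕ) : ℝ≥0∞) / (k : ℝ≥0∞)) • ((A.genFunOf T).diag k).negLog

/-- The iterates, from `0`, of the system `Tᵢ = E i` on generating functions. -/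
def Spec.iterate {ι : Type*} (E : ι → Spec ι) : ℕ → ι → ProfileSeries
  | 0 => fun _ => 0
  | N + 1 => fun i => (E i).genFunOf (Spec.iterate E N)

/-- The generating functions of the recursively defined classes: the least solution of the system,
which is the limit, coefficient by coefficient, of the (increasing) iterates. -/
def Spec.solution {ι : Type*} (E : ι → Spec ι) (i : ι) : ProfileSeries :=
  fun n => ⨆ N : ℕ, MvPowerSeries.coeff n (Spec.iterate E N i)

/-- The generating function `F_A` of the class described by the expression `A`. -/
def Spec.genFun {ι : Type*} (E : ι → Spec ι) (A : Spec ι) : ProfileSeries :=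
  A.genFunOf (Spec.solution E)

/-- The real number `F_A(s₁, s₂, …)`. -/
def Spec.value {ι : Type*} (E : ι → Spec ι) (A : Spec ι) (s : ℕ+ → ℝ≥0) : ℝ :=
  ((A.genFun E).eval s).toReal

/-! ### Samplers -/

/-- Random programs with values in `α`. The outcome `none` means that the program has no output. -/
abbrev Gen (α : Type) : Type := OptionT PMF α

/-- Draw an element following the law `p`. The program fails if `p` is not a probability law. -/
def draw {α : Type} (p : α → ℝ) : Gen α :=
  open Classical in
  if h : (∀ a, 0 ≤ p a) ∧ HasSum p 1 then
    OptionT.lift (⟨fun a => ENNReal.ofReal (p a), by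
      have := ENNReal.ofReal_tsum_of_nonneg h.1 h.2.summable
      rw [h.2.tsum_eq, ENNReal.ofReal_one] at this
      rw [this]
      exact ENNReal.summable.hasSum⟩ : PMF α)
  else failure

/-- The Bernoulli law of parameter `p`. -/
def bernoulliLaw (p : ℝ) : Bool → ℝ
  | true => p
  | false => 1 - p

/-- The geometric law of parameter `x`. -/
def geomLaw (x : ℝ) (k : ℕ) : ℝ := x ^ k * (1 - x)

/-- The Poisson law of parameter `x`. -/
def poissonLaw (x : ℝ) (k : ℕ) : ℝ := Real.exp (-x) * (x ^ k / k !)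

/-- The law of a Poisson variable of parameter `x` conditioned to be positive. -/
def posPoissonLaw (x : ℝ) (k : ℕ) : ℝ :=
  if k = 0 then 0 else 1 / (Real.exp x - 1) * (x ^ k / k !)

/-- The value `P(K ≤ k) = ∏_{j > k} exp (- x j)` of the distribution function used for multisets. -/
def maxIndexCdf (x : ℕ+ → ℝ) (k : ℕ+) : ℝ := ∏' j : Set.Ioi k, Real.exp (-x j)

/-- The law on the positive integers with distribution function `maxIndexCdf x`. -/
def maxIndexLaw (x : ℕ+ → ℝ) (k : ℕ+) : ℝ :=
  if k = 1 then maxIndexCdf x 1 else maxIndexCdf x k - maxIndexCdf x (k - 1)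

/-- The logarithmic law of parameter `x`. -/
def logLaw (x : ℝ) (l : ℕ+) : ℝ := -(x ^ (l : ℕ) / l) * (1 / Real.log (1 - x))

/-- The parameters `(s_k, s_{2k}, …)`. -/
def dilate (k : ℕ+) (s : ℕ+ → ℝ≥0) : ℕ+ → ℝ≥0 := fun i => s (k * i)

/-- Run `q` times the sampler `g` and concatenate the results, one after the other, to `S`. -/
def repeatConcat (g : Gen ProfiledWord) : ℕ → ProfiledWord → Gen ProfiledWord
  | 0, S => pure S
  | q + 1, S => do
      let A ← g
      repeatConcat g q (S.concat A)

/-- For `j = 1, …, m`: draw `q` following the Poisson law of parameter `x j`, run `q` times the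
sampler `g j` and concatenate the results to `S`. -/
def poissonLoop (x : ℕ+ → ℝ) (g : ℕ+ → Gen ProfiledWord) : ℕ → ProfiledWord → Gen ProfiledWord
  | 0, S => pure S
  | m + 1, S => do
      let S ← poissonLoop x g m S
      let q ← draw (poissonLaw (x m.succPNat))
      repeatConcat (g m.succPNat) q S

/-- The sampler of the class described by an expression, with parameters `s`, when the samplers
`call i` of the variables are given. -/
def Spec.samplerOf {ι : Type*} (E : ι → Spec ι)
    (call : ι → (ℕ+ → ℝ≥0) → Gen ProfiledWord) : Spec ι → (ℕ+ → ℝ≥0) → Gen ProfiledWord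
  | .neutral, _ => pure [.paren []]
  | .atom, _ => pure [.atom 0]
  | .var i, s => call i s
  | .sum A B, s => do
      let X ← draw (bernoulliLaw (A.value E s / (Spec.sum A B).value E s))
      if X then A.samplerOf E call s else B.samplerOf E call s
  | .prod A B, s => do
      let u ← A.samplerOf E call s
      let v ← B.samplerOf E call s
      return [.paren (u.concat v)]
  | .diag k A, s => do
      let w ← A.samplerOf E call (dilate k s)
      return w.diag k
  | .seq A, s => do
      let k ← draw (geomLaw (A.value E s))
      let S ← repeatConcat (A.samplerOf E call s) k []
      return [.paren S]
  | .mset A, s => do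
      let x : ℕ+ → ℝ := fun j => 1 / (j : ℝ) * A.value E (dilate j s)
      let g : ℕ+ → Gen ProfiledWord := fun j => do
        let w ← A.samplerOf E call (dilate j s)
        return w.diag j
      let k ← draw (maxIndexLaw x)
      if k = 1 then
        let q ← draw (poissonLaw (A.value E s))
        let S ← repeatConcat (A.samplerOf E call s) q []
        return [.brace S]
      else
        let S ← poissonLoop x g ((k : ℕ) - 1) []
        let q ← draw (posPoissonLaw (x k))
        let S ← repeatConcat (g k) q S
        return [.brace S]
  | .cyc A, s => do
      let k ← draw fun k : ℕ+ =>
        -(1 / (Spec.cyc A).value E s) * ((φ (k : ℕ) : ℝ) / (k : ℝ)) *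
          Real.log (1 - A.value E (dilate k s))
      let l ← draw (logLaw (A.value E (dilate k s)))
      let M ← repeatConcat (A.samplerOf E call (dilate k s)) (l : ℕ) []
      return [.bracket (M.diag k)]

/-- The samplers of the recursively defined classes: the sampler of the class `Tᵢ` runs the sampler
of `E i`. The run is stopped, without output, when `N` nested recursive calls are not enough. -/
def Spec.callSampler {ι : Type*} (E : ι → Spec ι) :
    ℕ → ι → (ℕ+ → ℝ≥0) → Gen ProfiledWord
  | 0 => fun _ _ => failure
  | N + 1 => fun i s => (E i).samplerOf E (Spec.callSampler E N) s

/-- The probability that the sampler of the class described by `A`, with parameters `s`, outputs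
(a word that represents) the profiled object `o` with at most `N` nested recursive calls. -/
def Spec.outputProb {ι : Type*} (E : ι → Spec ι) (A : Spec ι) (s : ℕ+ → ℝ≥0) (N : ℕ)
    (o : ProfiledObject) : ℝ≥0∞ :=
  (PMF.map (Option.map ProfiledWord.toObject)
    (A.samplerOf E (Spec.callSampler E N) s).run) (some o)

/-- The sampler of the class described by `A`, with parameters `s`, is a valid Boltzmann sampler for
profiled objects: it outputs almost surely an object, whose law `μ` is carried by the class, and the
profile has `nᵢ` parts of size `i` for all `i` with probability `[s^n] F_A * s^n / F_A(s)`. -/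
def Spec.IsBoltzmannSampler {ι : Type*} (E : ι → Spec ι) (A : Spec ι) (s : ℕ+ → ℝ≥0) : Prop :=
  ∃ μ : PMF ProfiledObject,
    (∀ o, Tendsto (fun N => A.outputProb E s N o) atTop (𝓝 (μ o))) ∧
    μ.support ⊆ A.objects E ∧
    ∀ n : ℕ+ →₀ ℕ, μ.toOuterMeasure {o | ∀ i, o.partCount i = n i} =
      MvPowerSeries.coeff n (A.genFun E) * ProfileSeries.monomialValue s n /
        (A.genFun E).eval s

end

/-! ### Algebra of the series -/

-- The law of the profile of a random word is encoded by its generating series `Gen.series`.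
-- Concatenation makes labels disjoint, so profiles add and independent draws multiply series; the
-- diagonal merges `k` copies of each part, so it acts on series by `ProfileSeries.diag`. The
-- Boltzmann property becomes F_A(s) • series = `scale s` F_A. This multiplicative form also makes
-- sense for subexpressions of value 0.
--
-- The identity is first proved for recursion cut off at depth N (`Spec.eval_smul_series_samplerOf`,
-- `Spec.eval_smul_series_callSampler`). The random choices use the values of the full generating
-- functions, yet F_A(s) times the series of the cut-off sampler is exactly the rescaled generating
-- function built from the N-th iterates. This goes by induction on the expression: each law has
-- weights proportional to a coefficient times a power x^q of the value x of the argument. The power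
-- combines with the q-th power of the argument's series into a power of its rescaled generating
-- function, and the normalizer cancels against F_A(s).
--
-- For multisets the law of K comes from the telescoping exp(∑ Y_j) = exp(Y_1) + ∑_{k>1} exp(Y_1 + ⋯
-- + Y_{k-1}) (exp(Y_k) - 1) (`sum_expIncrement`), whose k-th term is the contribution of the branch
-- K = k: Poisson numbers for j < k, a positive one for k.
--
-- Finally N → ∞. The probability of each output word increases with N, and so do the coefficients
-- of the generating functions, so suprema commute with all the sums (`ProfileSeries.IsMonoSup`).
-- Coefficient by coefficient this gives the law of the profile; summed over all coefficients it
-- gives total mass 1, that is, almost sure termination. That outputs lie in the class is a separate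
-- induction on words of nonzero mass.

theorem ENNReal.tsum_iSup_of_monotone {α : Type*} {f : ℕ → α → ℝ≥0∞}
    (hf : ∀ a, Monotone fun N => f N a) : ∑' a, ⨆ N, f N a = ⨆ N, ∑' a, f N a := by
  simp only [ENNReal.tsum_eq_iSup_sum]
  rw [iSup_comm]
  exact iSup_congr fun s => ENNReal.finsetSum_iSup_of_monotone hf

/-- Two indices `i` and `j` are both dominated by `max i j`, so the diagonal is cofinal. -/
theorem ENNReal.iSup_mul_iSup_of_monotone {f g : ℕ → ℝ≥0∞} (hf : Monotone f) (hg : Monotone g) :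
    (⨆ N, f N) * ⨆ N, g N = ⨆ N, f N * g N := by
  refine le_antisymm ?_ (iSup_le fun N => mul_le_mul' (le_iSup f N) (le_iSup g N))
  rw [ENNReal.iSup_mul]
  refine iSup_le fun i => ?_
  rw [ENNReal.mul_iSup]
  exact iSup_le fun j => le_trans (mul_le_mul' (hf (le_max_left i j)) (hg (le_max_right i j)))
    (le_iSup (fun N => f N * g N) (max i j))

/-- The antidiagonals are the fibres of addition, hence partition the pairs. -/
theorem ENNReal.tsum_sum_antidiagonal {A : Type*} [AddCommMonoid A] [Finset.HasAntidiagonal A]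
    (f : A × A → ℝ≥0∞) : ∑' n, ∑ p ∈ Finset.HasAntidiagonal.antidiagonal n, f p = ∑' p, f p := by
  rw [← Finset.HasAntidiagonal.sigmaAntidiagonalEquivProd.tsum_eq, ENNReal.tsum_sigma']
  refine tsum_congr fun n => ?_
  simp only [Finset.HasAntidiagonal.sigmaAntidiagonalEquivProd_apply]
  rw [tsum_fintype, Finset.sum_coe_sort (Finset.HasAntidiagonal.antidiagonal n) f]

noncomputable section

namespace ProfileSeries

open MvPowerSeries (coeff monomial coeff_mul coeff_smul)

theorem coeff_sum {α : Type} (f : α → ProfileSeries) (n : ℕ+ →₀ ℕ) :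
    coeff n (sum f) = ∑' a, coeff n (f a) := rfl

theorem mul_sum {α : Type} (F : ProfileSeries) (f : α → ProfileSeries) :
    F * sum f = sum fun a => F * f a := by
  ext n
  simp only [coeff_mul, coeff_sum, ← ENNReal.tsum_mul_left]
  rw [Summable.tsum_finsetSum fun _ _ => ENNReal.summable]

theorem sum_mul {α : Type} (f : α → ProfileSeries) (F : ProfileSeries) :
    sum f * F = sum fun a => f a * F := by
  simp only [mul_comm _ F, mul_sum]

theorem smul_sum {α : Type} (c : ℝ≥0∞) (f : α → ProfileSeries) :
    c • sum f = sum fun a => c • f a := by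
  ext n
  simp only [coeff_smul, coeff_sum, ENNReal.tsum_mul_left]

theorem sum_comm {α β : Type} (f : α → β → ProfileSeries) :
    (sum fun a => sum fun b => f a b) = sum fun b => sum fun a => f a b := by
  ext n
  simp only [coeff_sum]
  exact ENNReal.tsum_comm

/-- The sum of the coefficients of a series. -/
def total (F : ProfileSeries) : ℝ≥0∞ := ∑' n, coeff n F

/-- The series with coefficients `[s^n] F * s^n`. -/
def scale (s : ℕ+ → ℝ≥0) (F : ProfileSeries) : ProfileSeries :=
  fun n => coeff n F * monomialValue s n

theorem coeff_scale (s : ℕ+ → ℝ≥0) (F : ProfileSeries) (n : ℕ+ →₀ ℕ) :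
    coeff n (scale s F) = coeff n F * monomialValue s n := rfl

theorem eval_eq_total (s : ℕ+ → ℝ≥0) (F : ProfileSeries) : eval s F = total (scale s F) := rfl

theorem total_mul (F G : ProfileSeries) : total (F * G) = total F * total G := by
  simp only [total, coeff_mul]
  rw [ENNReal.tsum_sum_antidiagonal (fun p => coeff p.1 F * coeff p.2 G), ENNReal.tsum_prod']
  simp only [ENNReal.tsum_mul_left, ENNReal.tsum_mul_right]

theorem total_add (F G : ProfileSeries) : total (F + G) = total F + total G := by
  simp only [total, map_add, ENNReal.tsum_add]

theorem total_smul (c : ℝ≥0∞) (F : ProfileSeries) : total (c • F) = c * total F := by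
  simp only [total, coeff_smul, ENNReal.tsum_mul_left]

theorem total_sum {α : Type} (f : α → ProfileSeries) : total (sum f) = ∑' a, total (f a) := by
  simp only [total, coeff_sum]
  exact ENNReal.tsum_comm

theorem total_monomial (m : ℕ+ →₀ ℕ) (c : ℝ≥0∞) : total (monomial m c) = c := by
  classical
  simp only [total, MvPowerSeries.coeff_monomial, tsum_ite_eq]

theorem total_one : total 1 = 1 := total_monomial 0 1

theorem total_pow (F : ProfileSeries) (l : ℕ) : total (F ^ l) = total F ^ l := by
  induction l with
  | zero => rw [pow_zero, pow_zero, total_one]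
  | succ l ih => rw [pow_succ, pow_succ, total_mul, ih]

/-- Expressing the substitution as a combination of monomials makes its linearity visible and
reduces its other properties to monomials. -/
theorem diag_eq_sum (k : ℕ+) (F : ProfileSeries) :
    diag k F = sum fun m => coeff m F • monomial (m.mapDomain fun i => k * i) 1 := by
  classical
  ext n
  rw [coeff_sum]
  refine tsum_congr fun m => ?_
  rw [coeff_smul, MvPowerSeries.coeff_monomial]
  by_cases h : m.mapDomain (fun i => k * i) = n
  · simp [h]
  · simp [h, Ne.symm h]

theorem diag_sum {α : Type} (k : ℕ+) (f : α → ProfileSeries) :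
    diag k (sum f) = sum fun a => diag k (f a) := by
  simp only [diag_eq_sum]
  rw [sum_comm]
  ext n
  simp only [coeff_sum, coeff_smul, ENNReal.tsum_mul_right]

theorem diag_smul (k : ℕ+) (c : ℝ≥0∞) (F : ProfileSeries) : diag k (c • F) = c • diag k F := by
  simp only [diag_eq_sum, smul_sum, coeff_smul, mul_smul]

theorem diag_monomial (k : ℕ+) (m : ℕ+ →₀ ℕ) :
    diag k (monomial m 1) = monomial (m.mapDomain fun i => k * i) 1 := by
  classical
  ext n
  rw [diag_eq_sum, coeff_sum, tsum_eq_single m]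
  · simp
  · intro m' h
    simp [MvPowerSeries.coeff_monomial, h]

/-- The substitution moves monomials and carries their coefficients along, so the sum of the
coefficients does not change. -/
theorem total_diag (k : ℕ+) (F : ProfileSeries) : total (diag k F) = total F := by
  rw [diag_eq_sum, total_sum]
  simp only [total_smul, total_monomial, mul_one]
  rfl

/-- Both sides are bilinear, also for infinite sums, so monomials suffice; there the claim is the
additivity of `Finsupp.mapDomain`. -/
theorem diag_mul (k : ℕ+) (F G : ProfileSeries) : diag k (F * G) = diag k F * diag k G := by
  classical
  have hm : ∀ H : ProfileSeries, H = sum fun m => coeff m H • monomial m 1 := by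
    intro H
    ext n
    rw [coeff_sum, tsum_eq_single n]
    · simp
    · intro m' h
      simp [MvPowerSeries.coeff_monomial, Ne.symm h]
  conv_lhs => rw [hm F, hm G]
  conv_rhs => rw [diag_eq_sum, diag_eq_sum]
  simp only [sum_mul, mul_sum, diag_sum, smul_mul_assoc, mul_smul_comm, diag_smul,
    MvPowerSeries.monomial_mul_monomial, mul_one, diag_monomial, Finsupp.mapDomain_add]

theorem diag_one (k : ℕ+) : diag k 1 = 1 := by
  have := diag_monomial k 0
  rwa [Finsupp.mapDomain_zero] at this

theorem diag_pow (k : ℕ+) (F : ProfileSeries) (l : ℕ) : diag k (F ^ l) = diag k F ^ l := by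
  induction l with
  | zero => rw [pow_zero, pow_zero, diag_one]
  | succ l ih => rw [pow_succ, pow_succ, diag_mul, ih]

-- Rescaling of series by the parameters

theorem monomialValue_zero (s : ℕ+ → ℝ≥0) : monomialValue s 0 = 1 := Finsupp.prod_zero_index

theorem monomialValue_add (s : ℕ+ → ℝ≥0) (m n : ℕ+ →₀ ℕ) :
    monomialValue s (m + n) = monomialValue s m * monomialValue s n :=
  Finsupp.prod_add_index' (fun _ => pow_zero _) fun _ _ _ => pow_add _ _ _

theorem monomialValue_mapDomain (s : ℕ+ → ℝ≥0) (k : ℕ+) (m : ℕ+ →₀ ℕ) :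
    monomialValue s (m.mapDomain fun i => k * i) = monomialValue (dilate k s) m :=
  Finsupp.prod_mapDomain_index (fun _ => pow_zero _) fun _ _ _ => pow_add _ _ _

theorem scale_add (s : ℕ+ → ℝ≥0) (F G : ProfileSeries) :
    scale s (F + G) = scale s F + scale s G := by
  ext n
  simp only [coeff_scale, map_add, add_mul]

theorem scale_smul (s : ℕ+ → ℝ≥0) (c : ℝ≥0∞) (F : ProfileSeries) :
    scale s (c • F) = c • scale s F := by
  ext n
  simp only [coeff_scale, coeff_smul, mul_assoc]

theorem scale_sum {α : Type} (s : ℕ+ → ℝ≥0) (f : α → ProfileSeries) :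
    scale s (sum f) = sum fun a => scale s (f a) := by
  ext n
  simp only [coeff_scale, coeff_sum, ENNReal.tsum_mul_right]

theorem scale_monomial (s : ℕ+ → ℝ≥0) (m : ℕ+ →₀ ℕ) :
    scale s (monomial m 1) = monomialValue s m • monomial m 1 := by
  classical
  ext n
  by_cases h : n = m
  · simp [coeff_scale, h]
  · simp [coeff_scale, MvPowerSeries.coeff_monomial, h]

theorem scale_one (s : ℕ+ → ℝ≥0) : scale s 1 = 1 := by
  have := scale_monomial s 0
  rwa [monomialValue_zero, one_smul] at this

theorem scale_mul (s : ℕ+ → ℝ≥0) (F G : ProfileSeries) :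
    scale s (F * G) = scale s F * scale s G := by
  ext n
  simp only [coeff_scale, coeff_mul, Finset.sum_mul]
  refine Finset.sum_congr rfl fun p hp => ?_
  rw [← Finset.HasAntidiagonal.mem_antidiagonal.1 hp, monomialValue_add]
  ring

theorem scale_pow (s : ℕ+ → ℝ≥0) (F : ProfileSeries) (l : ℕ) :
    scale s (F ^ l) = scale s F ^ l := by
  induction l with
  | zero => rw [pow_zero, pow_zero, scale_one]
  | succ l ih => rw [pow_succ, pow_succ, scale_mul, ih]

/-- Evaluating s_{ki} at the parameters is evaluating s_i at the dilated ones; this is why the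
sampler of a diagonal runs its argument with `dilate k s`. -/
theorem scale_diag (s : ℕ+ → ℝ≥0) (k : ℕ+) (F : ProfileSeries) :
    scale s (diag k F) = diag k (scale (dilate k s) F) := by
  simp only [diag_eq_sum, scale_sum, scale_smul, scale_monomial, monomialValue_mapDomain,
    coeff_scale, mul_smul]

theorem scale_geom (s : ℕ+ → ℝ≥0) (F : ProfileSeries) : scale s F.geom = (scale s F).geom := by
  simp only [geom, scale_sum, scale_pow]

theorem scale_exp (s : ℕ+ → ℝ≥0) (F : ProfileSeries) : scale s F.exp = (scale s F).exp := by
  simp only [exp, scale_sum, scale_smul, scale_pow]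

theorem scale_negLog (s : ℕ+ → ℝ≥0) (F : ProfileSeries) :
    scale s F.negLog = (scale s F).negLog := by
  simp only [negLog, scale_sum, scale_smul, scale_pow]

theorem total_geom (F : ProfileSeries) : total F.geom = (1 - total F)⁻¹ := by
  simp only [geom, total_sum, total_pow, ENNReal.tsum_geometric]

theorem total_exp (F : ProfileSeries) :
    total F.exp = ∑' l : ℕ, (l ! : ℝ≥0∞)⁻¹ * total F ^ l := by
  simp only [exp, total_sum, total_smul, total_pow]

theorem total_negLog (F : ProfileSeries) :
    total F.negLog = ∑' l : ℕ+, (l : ℝ≥0∞)⁻¹ * total F ^ (l : ℕ) := by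
  simp only [negLog, total_sum, total_smul, total_pow]

-- The exponential of a series

theorem exp_zero : exp 0 = 1 := by
  ext n
  rw [exp, coeff_sum, tsum_eq_single 0]
  · simp
  · intro l hl
    simp [zero_pow hl]

/-- The double sum over (i, j) is grouped by l = i + j, and each group is the binomial expansion of
(F + G)^l / l!. -/
theorem exp_add (F G : ProfileSeries) : exp (F + G) = exp F * exp G := by
  have h : ∀ i j : ℕ, ((i + j)! : ℝ≥0∞)⁻¹ * ((i + j).choose i : ℝ≥0∞) =
      (i ! : ℝ≥0∞)⁻¹ * (j ! : ℝ≥0∞)⁻¹ := by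
    intro i j
    have h0 : ∀ m : ℕ, (m ! : ℝ≥0∞) ≠ 0 := fun m => by exact_mod_cast m.factorial_ne_zero
    have ht : ∀ m : ℕ, (m ! : ℝ≥0∞) ≠ ∞ := fun m => ENNReal.natCast_ne_top _
    have := Nat.add_choose_mul_factorial_mul_factorial i j
    rw [← Nat.choose_symm_add] at this
    have e : (((i + j).choose i : ℕ) : ℝ≥0∞) * ((i ! : ℝ≥0∞) * (j ! : ℝ≥0∞)) = ((i + j)! : ℝ≥0∞) := by
      rw [← mul_assoc]; exact_mod_cast this
    rw [← ENNReal.mul_inv (Or.inl (h0 i)) (Or.inl (ht i)), ← e,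
      ENNReal.mul_inv (Or.inr (ENNReal.mul_ne_top (ht i) (ht j)))
        (Or.inr (mul_ne_zero (h0 i) (h0 j))), mul_right_comm, ENNReal.inv_mul_cancel, one_mul]
    · exact_mod_cast (Nat.choose_pos (Nat.le_add_right i j)).ne'
    · exact ENNReal.natCast_ne_top _
  ext n
  simp only [exp, sum_mul, mul_sum, coeff_sum]
  rw [ENNReal.tsum_comm, ← ENNReal.tsum_prod (f := fun i j => coeff n
    (((i ! : ℝ≥0∞)⁻¹ • F ^ i) * ((j ! : ℝ≥0∞)⁻¹ • G ^ j))), ← ENNReal.tsum_sum_antidiagonal]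
  refine tsum_congr fun l => ?_
  rw [(Commute.all F G).add_pow', Finset.smul_sum, map_sum]
  refine Finset.sum_congr rfl fun p hp => ?_
  rw [← Finset.HasAntidiagonal.mem_antidiagonal.1 hp, smul_mul_smul_comm, coeff_smul, coeff_smul, ← h,
    map_nsmul, nsmul_eq_mul, mul_assoc]

theorem exp_eq_one_add (F : ProfileSeries) :
    exp F = 1 + sum fun l : ℕ => ((l + 1)! : ℝ≥0∞)⁻¹ • F ^ (l + 1) := by
  ext n
  rw [exp, coeff_sum, tsum_eq_zero_add' ENNReal.summable]
  simp [coeff_sum]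

/-! ### Increasing sequences of series -/

/-- The sequence `F` increases coefficient by coefficient, with limit `G`. -/
structure IsMonoSup (F : ℕ → ProfileSeries) (G : ProfileSeries) : Prop where
  mono : ∀ n, Monotone fun N => coeff n (F N)
  sup : ∀ n, coeff n G = ⨆ N, coeff n (F N)

namespace IsMonoSup

variable {F F' : ℕ → ProfileSeries} {G G' : ProfileSeries}

theorem const (G : ProfileSeries) : IsMonoSup (fun _ => G) G :=
  ⟨fun _ => monotone_const, fun _ => ciSup_const.symm⟩

theorem le (h : IsMonoSup F G) (N : ℕ) (n : ℕ+ →₀ ℕ) : coeff n (F N) ≤ coeff n G := by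
  rw [h.sup]
  exact le_iSup (fun N => coeff n (F N)) N

theorem unique (h : IsMonoSup F G) (h' : IsMonoSup F G') : G = G' := by
  ext n
  rw [h.sup, h'.sup]

theorem succ (h : IsMonoSup F G) : IsMonoSup (fun N => F (N + 1)) G :=
  ⟨fun n _ _ hab => h.mono n (Nat.succ_le_succ hab),
    fun n => by rw [h.sup, (h.mono n).iSup_nat_add 1]⟩

theorem add (h : IsMonoSup F G) (h' : IsMonoSup F' G') :
    IsMonoSup (fun N => F N + F' N) (G + G') := by
  refine ⟨fun n => ?_, fun n => ?_⟩
  · simp only [map_add]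
    exact (h.mono n).add (h'.mono n)
  · simp only [map_add, h.sup, h'.sup]
    exact ENNReal.iSup_add_iSup_of_monotone (h.mono n) (h'.mono n)

/-- A coefficient of a product is a finite sum of products of two increasing sequences, for each of
which the supremum passes inside. -/
theorem mul (h : IsMonoSup F G) (h' : IsMonoSup F' G') :
    IsMonoSup (fun N => F N * F' N) (G * G') := by
  have hm : ∀ p : (ℕ+ →₀ ℕ) × (ℕ+ →₀ ℕ),
      Monotone fun N => coeff p.1 (F N) * coeff p.2 (F' N) :=
    fun p => (h.mono p.1).mul' (h'.mono p.2)
  refine ⟨fun n => ?_, fun n => ?_⟩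
  · simp only [coeff_mul]
    exact fun a b hab => Finset.sum_le_sum fun p _ => hm p hab
  · simp only [coeff_mul, h.sup, h'.sup]
    rw [← ENNReal.finsetSum_iSup_of_monotone hm]
    exact Finset.sum_congr rfl fun p _ =>
      ENNReal.iSup_mul_iSup_of_monotone (h.mono p.1) (h'.mono p.2)

theorem pow (h : IsMonoSup F G) (l : ℕ) : IsMonoSup (fun N => F N ^ l) (G ^ l) := by
  induction l with
  | zero => simpa only [pow_zero] using const 1
  | succ l ih => simpa only [pow_succ] using ih.mul h

theorem smul (c : ℝ≥0∞) (h : IsMonoSup F G) : IsMonoSup (fun N => c • F N) (c • G) := by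
  refine ⟨fun n => ?_, fun n => ?_⟩
  · simp only [coeff_smul]
    exact (h.mono n).const_mul' c
  · simp only [coeff_smul, h.sup, ENNReal.mul_iSup]

theorem sum {α : Type} {f : ℕ → α → ProfileSeries} {g : α → ProfileSeries}
    (h : ∀ a, IsMonoSup (fun N => f N a) (g a)) :
    IsMonoSup (fun N => ProfileSeries.sum (f N)) (ProfileSeries.sum g) := by
  refine ⟨fun n a b hab => ENNReal.tsum_le_tsum fun x => (h x).mono n hab, fun n => ?_⟩
  simp only [coeff_sum, fun a => (h a).sup n]
  exact ENNReal.tsum_iSup_of_monotone fun a => (h a).mono n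

theorem diag (k : ℕ+) (h : IsMonoSup F G) : IsMonoSup (fun N => (F N).diag k) (G.diag k) := by
  simp only [diag_eq_sum]
  refine sum fun m => ⟨fun n => ?_, fun n => ?_⟩
  · simp only [coeff_smul]
    exact (h.mono m).mul_const' _
  · simp only [coeff_smul, h.sup m, ENNReal.iSup_mul]

theorem geom (h : IsMonoSup F G) : IsMonoSup (fun N => (F N).geom) G.geom :=
  sum fun l => h.pow l

theorem exp (h : IsMonoSup F G) : IsMonoSup (fun N => (F N).exp) G.exp :=
  sum fun l => (h.pow l).smul _

theorem negLog (h : IsMonoSup F G) : IsMonoSup (fun N => (F N).negLog) G.negLog :=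
  sum fun l => (h.pow l).smul _

theorem scale (s : ℕ+ → ℝ≥0) (h : IsMonoSup F G) :
    IsMonoSup (fun N => (F N).scale s) (G.scale s) := by
  refine ⟨fun n => ?_, fun n => ?_⟩
  · simp only [coeff_scale]
    exact (h.mono n).mul_const' _
  · simp only [coeff_scale, h.sup n, ENNReal.iSup_mul]

theorem total (h : IsMonoSup F G) : G.total = ⨆ N, (F N).total := by
  simp only [ProfileSeries.total, h.sup]
  exact ENNReal.tsum_iSup_of_monotone h.mono

/-- The partial sums of a series of series. -/
theorem sum_range (f : ℕ → ProfileSeries) :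
    IsMonoSup (fun N => ∑ j ∈ Finset.range N, f j) (ProfileSeries.sum f) := by
  refine ⟨fun n => ?_, fun n => ?_⟩
  · simp only [map_sum]
    exact fun a b hab => Finset.sum_le_sum_of_subset (Finset.range_mono hab)
  · simp only [map_sum, coeff_sum]
    exact ENNReal.tsum_eq_iSup_nat

end IsMonoSup

end ProfileSeries

/-! ### The generating functions -/

namespace Spec

open MvPowerSeries (coeff)

open ProfileSeries (IsMonoSup)

/-- Every construction is made of sums, products and substitutions with nonnegative coefficients,
all of which commute with increasing limits. -/
theorem isMonoSup_genFunOf {ι : Type*} {T : ℕ → ι → ProfileSeries} {S : ι → ProfileSeries}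
    (h : ∀ i, IsMonoSup (fun N => T N i) (S i)) (A : Spec ι) :
    IsMonoSup (fun N => A.genFunOf (T N)) (A.genFunOf S) := by
  induction A with
  | neutral => exact .const _
  | atom => exact .const _
  | var i => exact h i
  | sum A B hA hB => exact hA.add hB
  | prod A B hA hB => exact hA.mul hB
  | diag k A hA => exact hA.diag k
  | seq A hA => exact hA.geom
  | mset A hA => exact (IsMonoSup.sum fun k => (hA.diag k).smul _).exp
  | cyc A hA => exact IsMonoSup.sum fun k => (hA.diag k).negLog.smul _

theorem genFunOf_mono {ι : Type*} {T S : ι → ProfileSeries}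
    (h : ∀ i n, coeff n (T i) ≤ coeff n (S i)) (A : Spec ι) (n : ℕ+ →₀ ℕ) :
    coeff n (A.genFunOf T) ≤ coeff n (A.genFunOf S) := by
  -- Monotonicity is read off from continuity along the increasing sequence T, S, S, ….
  have hs : ∀ i, IsMonoSup (fun N => (fun N => if N = 0 then T else S) N i) (S i) := by
    intro i
    refine ⟨fun m => monotone_nat_of_le_succ fun N => ?_, fun m => le_antisymm ?_ ?_⟩
    · by_cases hN : N = 0
      · simpa [hN] using h i m
      · simp [hN]
    · exact le_iSup_of_le 1 (by simp)
    · refine iSup_le fun N => ?_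
      by_cases hN : N = 0
      · simpa [hN] using h i m
      · simp [hN]
  simpa using (isMonoSup_genFunOf hs A).le 0 n

theorem iterate_mono {ι : Type*} (E : ι → Spec ι) (N : ℕ) (i : ι) (n : ℕ+ →₀ ℕ) :
    coeff n (iterate E N i) ≤ coeff n (iterate E (N + 1) i) := by
  induction N generalizing i n with
  | zero => exact zero_le
  | succ N ih => exact genFunOf_mono ih (E i) n

theorem isMonoSup_iterate {ι : Type*} (E : ι → Spec ι) (i : ι) :
    IsMonoSup (fun N => iterate E N i) (solution E i) :=
  ⟨fun n => monotone_nat_of_le_succ fun N => iterate_mono E N i n, fun _ => rfl⟩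

/-- Kleene's fixed point argument: the iterates shifted by one have the same supremum, and by
continuity it is also the image of the limit. -/
theorem solution_eq {ι : Type*} (E : ι → Spec ι) (i : ι) : solution E i = (E i).genFun E :=
  (isMonoSup_iterate E i).succ.unique (isMonoSup_genFunOf (isMonoSup_iterate E) (E i))

end Spec

end

/-! ### Profiles of words -/

noncomputable section

/-- The multiset of the multiplicities of the elements of a list. -/
def List.multiplicities (L : List ℕ) : ℕ+ →₀ ℕ :=
  ∑ b ∈ L.toFinset, Finsupp.single (L.count b).toPNat' 1

theorem List.multiplicities_apply (L : List ℕ) (i : ℕ+) :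
    L.multiplicities i = (L.toFinset.filter fun b => L.count b = i).card := by
  rw [multiplicities, Finsupp.finsetSum_apply, Finset.card_filter]
  refine Finset.sum_congr rfl fun b hb => ?_
  -- Positivity matters because `Nat.toPNat'` would send a count 0 to the size 1.
  have hpos : 0 < L.count b := List.count_pos_iff.2 (List.mem_toFinset.1 hb)
  rw [Finsupp.single_apply]
  refine if_congr ?_ rfl rfl
  rw [← PNat.coe_inj, Nat.toPNat'_coe, if_pos hpos]

theorem List.multiplicities_map {g : ℕ → ℕ} (hg : g.Injective) (L : List ℕ) :
    (L.map g).multiplicities = L.multiplicities := by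
  have h : (L.map g).toFinset = L.toFinset.map ⟨g, hg⟩ := by
    ext b
    simp
  rw [multiplicities, h, Finset.sum_map]
  refine Finset.sum_congr rfl fun b _ => ?_
  rw [Function.Embedding.coeFn_mk, List.count_map_of_injective _ _ hg]

theorem List.multiplicities_append {L M : List ℕ} (h : L.Disjoint M) :
    (L ++ M).multiplicities = L.multiplicities + M.multiplicities := by
  rw [multiplicities, List.toFinset_append, Finset.sum_union (List.disjoint_toFinset_iff_disjoint.2 h)]
  refine congrArg₂ _ (Finset.sum_congr rfl fun b hb => ?_) (Finset.sum_congr rfl fun b hb => ?_)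
  · rw [List.count_append, List.count_eq_zero_of_not_mem (h (List.mem_toFinset.1 hb)), add_zero]
  · rw [List.count_append,
      List.count_eq_zero_of_not_mem (fun hL => h hL (List.mem_toFinset.1 hb)), zero_add]

/-- Repeating a list `k` times keeps its set of labels and multiplies each count by `k`. -/
theorem List.multiplicities_replicate_flatten (k : ℕ+) (L : List ℕ) :
    ((List.replicate (k : ℕ) L).flatten).multiplicities =
      L.multiplicities.mapDomain fun i => k * i := by
  have h : ((List.replicate (k : ℕ) L).flatten).toFinset = L.toFinset := by
    ext b
    simp [List.mem_flatten]
  rw [multiplicities, h, multiplicities, Finsupp.mapDomain_finsetSum]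
  refine Finset.sum_congr rfl fun b hb => ?_
  have hpos : 0 < L.count b := List.count_pos_iff.2 (List.mem_toFinset.1 hb)
  rw [Finsupp.mapDomain_single]
  congr 1
  rw [← PNat.coe_inj, Nat.toPNat'_coe, PNat.mul_coe, Nat.toPNat'_coe, if_pos hpos,
    List.count_flatten, List.map_replicate, List.sum_replicate, smul_eq_mul,
    if_pos (Nat.mul_pos k.pos hpos)]

namespace ProfiledWord

/-- The numbers of parts of each size of the partition, as a finitely supported family. -/
def profile (w : ProfiledWord) : ℕ+ →₀ ℕ := (Proto.atomsWord w).multiplicities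

theorem profile_apply (w : ProfiledWord) (i : ℕ+) : w.profile i = w.partCount i :=
  List.multiplicities_apply _ i

theorem profile_eq_iff (w : ProfiledWord) (n : ℕ+ →₀ ℕ) :
    w.profile = n ↔ ∀ i, w.toObject.partCount i = n i := by
  simp only [DFunLike.ext_iff, profile_apply]
  rfl

theorem atomsWord_append (u v : ProfiledWord) :
    Proto.atomsWord (u ++ v) = Proto.atomsWord u ++ Proto.atomsWord v := by
  simp only [Proto.atomsWord_eq_flatMap, List.flatMap_append]

theorem profile_concat (u v : ProfiledWord) : (u.concat v).profile = u.profile + v.profile := by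
  rw [profile, concat, atomsWord_append, Proto.atomsWord_recolorWord, Proto.atomsWord_recolorWord,
    List.multiplicities_append, List.multiplicities_map, List.multiplicities_map]
  · rfl
  · intro a b h
    simpa using h
  · intro a b h
    simpa using h
  -- The labels of the first word have become even and those of the second odd, so no part is
  -- shared.
  · intro b hb hb'
    obtain ⟨c, -, rfl⟩ := List.mem_map.1 hb
    obtain ⟨d, -, hd⟩ := List.mem_map.1 hb'
    omega

theorem profile_diag (k : ℕ+) (w : ProfiledWord) :
    (w.diag k).profile = w.profile.mapDomain fun i => k * i := by
  have h : ∀ m : ℕ, Proto.atomsWord (List.replicate m w).flatten =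
      (List.replicate m (Proto.atomsWord w)).flatten := by
    intro m
    induction m with
    | zero => rfl
    | succ m ih =>
      rw [List.replicate_succ, List.flatten_cons, atomsWord_append, ih, List.replicate_succ,
        List.flatten_cons]
  rw [profile, diag, h, List.multiplicities_replicate_flatten]
  rfl

theorem profile_nil : profile [] = 0 := rfl

theorem profile_paren (w : ProfiledWord) : profile [.paren w] = w.profile := by
  simp [profile, Proto.atomsWord, Proto.atoms]

theorem profile_bracket (w : ProfiledWord) : profile [.bracket w] = w.profile := by
  simp [profile, Proto.atomsWord, Proto.atoms]

theorem profile_brace (w : ProfiledWord) : profile [.brace w] = w.profile := by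
  simp [profile, Proto.atomsWord, Proto.atoms]

theorem profile_atom (b : ℕ) : profile [.atom b] = Finsupp.single 1 1 := by
  have h : Nat.toPNat' 1 = 1 := rfl
  simp [profile, Proto.atomsWord, Proto.atoms, List.multiplicities, h]

end ProfiledWord

/-! ### Laws of random programs -/

/-- The probability that a random program outputs `a`. -/
def Gen.mass {α : Type} (g : Gen α) (a : α) : ℝ≥0∞ := g.run (some a)

namespace Gen

variable {α β : Type}

theorem mass_pure (a b : α) [Decidable (b = a)] :
    mass (pure a : Gen α) b = if b = a then 1 else 0 := by
  classical
  have h : (pure a : Gen α).run = PMF.pure (some a) := rfl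
  rw [mass, h, PMF.pure_apply]
  simp

theorem mass_failure (a : α) : mass (failure : Gen α) a = 0 := by
  have h : (failure : Gen α).run = PMF.pure none := rfl
  rw [mass, h, PMF.pure_apply]
  simp

theorem mass_bind (g : Gen α) (f : α → Gen β) (b : β) :
    mass (g >>= f) b = ∑' a, mass g a * mass (f a) b := by
  have h : (g >>= f).run = g.run.bind fun o => o.elim (PMF.pure none) fun a => (f a).run := by
    rw [OptionT.run_bind]
    rfl
  -- The sum over outcomes splits into values and `none`; the latter cannot lead to an output.
  rw [mass, h, PMF.bind_apply, ← (Equiv.optionEquivSumPUnit.{0} α).symm.tsum_eq,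
    ENNReal.summable.tsum_sum ENNReal.summable]
  simp [mass, PMF.pure_apply]

theorem mass_bind_ne_zero {g : Gen α} {f : α → Gen β} {b : β} (h : mass (g >>= f) b ≠ 0) :
    ∃ a, mass g a ≠ 0 ∧ mass (f a) b ≠ 0 := by
  rw [mass_bind, Ne, ENNReal.tsum_eq_zero, not_forall] at h
  obtain ⟨a, ha⟩ := h
  exact ⟨a, left_ne_zero_of_mul ha, right_ne_zero_of_mul ha⟩

theorem mass_bind_mono {g g' : Gen α} {f f' : α → Gen β} (hg : ∀ a, mass g a ≤ mass g' a)
    (hf : ∀ a b, mass (f a) b ≤ mass (f' a) b) (b : β) :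
    mass (g >>= f) b ≤ mass (g' >>= f') b := by
  rw [mass_bind, mass_bind]
  exact ENNReal.tsum_le_tsum fun a => mul_le_mul' (hg a) (hf a b)

/-- This discharges the guard in `draw`: a real law that comes from a family in [0, ∞] of sum 1 is
accepted, and the rest of the computation can stay in [0, ∞]. -/
theorem mass_draw {p : α → ℝ} {q : α → ℝ≥0∞} (hp : ∀ a, p a = (q a).toReal)
    (hq : ∑' a, q a = 1) (a : α) : mass (draw p) a = q a := by
  have hfin : ∀ a, q a ≠ ∞ := ENNReal.ne_top_of_tsum_ne_top (by rw [hq]; exact ENNReal.one_ne_top)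
  have h : (∀ a, 0 ≤ p a) ∧ HasSum p 1 := by
    refine ⟨fun a => by rw [hp]; exact ENNReal.toReal_nonneg, ?_⟩
    have : p = fun a => (q a).toReal := funext hp
    rw [this]
    have hs := ENNReal.hasSum_toReal (f := q) (by rw [hq]; exact ENNReal.one_ne_top)
    rwa [← ENNReal.tsum_toReal_eq hfin, hq, ENNReal.toReal_one] at hs
  have hrun : ∀ m : PMF α, mass (OptionT.lift m : Gen α) a = m a := by
    intro m
    have : (OptionT.lift m : Gen α).run = m.bind fun a => PMF.pure (some a) := by
      rw [OptionT.run_lift]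
      rfl
    rw [mass, this, PMF.bind_apply, tsum_eq_single a]
    · rw [PMF.pure_apply, if_pos rfl, mul_one]
    · intro b hb
      rw [PMF.pure_apply, if_neg fun e => hb (Option.some.inj e).symm, mul_zero]
  rw [draw, dif_pos h]
  refine (hrun _).trans ?_
  change ENNReal.ofReal (p a) = q a
  rw [hp, ENNReal.ofReal_toReal (hfin a)]

/-! ### Profile generating series of random words -/

open MvPowerSeries (coeff monomial coeff_smul)

open ProfileSeries (sum)

/-- The generating series of the law of the profile of a random word. -/
def series (g : Gen ProfiledWord) : ProfileSeries :=
  sum fun w => mass g w • monomial w.profile 1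

theorem coeff_series (g : Gen ProfiledWord) (n : ℕ+ →₀ ℕ) [∀ w : ProfiledWord, Decidable (w.profile = n)] :
    coeff n (series g) = ∑' w : ProfiledWord, if w.profile = n then mass g w else 0 := by
  classical
  rw [series, ProfileSeries.coeff_sum]
  refine tsum_congr fun w => ?_
  rw [coeff_smul, MvPowerSeries.coeff_monomial]
  by_cases h : w.profile = n
  · simp [h]
  · simp [h, Ne.symm h]

theorem total_series (g : Gen ProfiledWord) : (series g).total = ∑' w, mass g w := by
  simp only [series, ProfileSeries.total_sum, ProfileSeries.total_smul,
    ProfileSeries.total_monomial, mul_one]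

theorem series_pure (w : ProfiledWord) : series (pure w) = monomial w.profile 1 := by
  classical
  ext n
  rw [series, ProfileSeries.coeff_sum, tsum_eq_single w]
  · simp [mass_pure]
  · intro w' h
    simp [mass_pure, h]

theorem series_failure : series failure = 0 := by
  ext n
  simp [series, ProfileSeries.coeff_sum, mass_failure]

theorem series_bind (g : Gen α) (f : α → Gen ProfiledWord) :
    series (g >>= f) = sum fun a => mass g a • series (f a) := by
  ext n
  simp only [series, ProfileSeries.smul_sum, ProfileSeries.coeff_sum, coeff_smul, mass_bind,
    ← ENNReal.tsum_mul_right]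
  rw [ENNReal.tsum_comm]
  simp only [mul_assoc]

/-- If the series of `f w` is that of `w` times `H`, then running `f` after `g` multiplies the
series of `g` by `H`. -/
theorem series_bind_mul (g : Gen ProfiledWord) {f : ProfiledWord → Gen ProfiledWord}
    {H : ProfileSeries} (hf : ∀ w, series (f w) = monomial w.profile 1 * H) :
    series (g >>= f) = series g * H := by
  rw [series_bind, series, ProfileSeries.sum_mul]
  simp only [hf, smul_mul_assoc]

theorem series_bind_pure (g : Gen ProfiledWord) {c : ProfiledWord → ProfiledWord}
    (hc : ∀ w, (c w).profile = w.profile) : series (g >>= fun w => pure (c w)) = series g := by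
  rw [series_bind_mul (H := 1), mul_one]
  intro w
  rw [series_pure, hc, mul_one]

theorem series_bind_diag (k : ℕ+) (g : Gen ProfiledWord) {c : ProfiledWord → ProfiledWord}
    (hc : ∀ w, (c w).profile = (w.diag k).profile) :
    series (g >>= fun w => pure (c w)) = (series g).diag k := by
  rw [series_bind]
  simp only [series_pure, hc, ProfiledWord.profile_diag]
  simp only [series, ProfileSeries.diag_sum, ProfileSeries.diag_smul, ProfileSeries.diag_monomial]

/-- Profiles add under concatenation, so each independent run contributes one factor. -/
theorem series_repeatConcat (g : Gen ProfiledWord) (q : ℕ) (S : ProfiledWord) :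
    series (repeatConcat g q S) = monomial S.profile 1 * series g ^ q := by
  induction q generalizing S with
  | zero => rw [repeatConcat, series_pure, pow_zero, mul_one]
  | succ q ih =>
    rw [repeatConcat, series_bind]
    simp only [ih, ProfiledWord.profile_concat]
    rw [pow_succ', ← mul_assoc]
    conv_rhs =>
      enter [1, 2]
      rw [series]
    rw [ProfileSeries.mul_sum, ProfileSeries.sum_mul]
    simp only [mul_smul_comm, smul_mul_assoc, MvPowerSeries.monomial_mul_monomial, mul_one]

/-- The series of the concatenation of a random number of independent words. -/
theorem series_draw_repeatConcat (p : ℕ → ℝ) (g : Gen ProfiledWord) (S : ProfiledWord) :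
    series (draw p >>= fun q => repeatConcat g q S) =
      monomial S.profile 1 * sum fun q => mass (draw p) q • series g ^ q := by
  rw [series_bind, ProfileSeries.mul_sum]
  simp only [series_repeatConcat, mul_smul_comm]

theorem series_poissonLoop (x : ℕ+ → ℝ) (g : ℕ+ → Gen ProfiledWord) (m : ℕ) (S : ProfiledWord) :
    series (poissonLoop x g m S) = monomial S.profile 1 * ∏ j ∈ Finset.range m,
      sum fun q => mass (draw (poissonLaw (x j.succPNat))) q • series (g j.succPNat) ^ q := by
  induction m with
  | zero => rw [poissonLoop, series_pure, Finset.prod_range_zero, mul_one]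
  | succ m ih =>
    rw [poissonLoop, series_bind_mul _ fun w => series_draw_repeatConcat _ _ w, ih,
      Finset.prod_range_succ, mul_assoc]

end Gen

end

noncomputable section

/-! ### Exponential and logarithmic sums -/

namespace ProfileSeries

open MvPowerSeries (coeff monomial coeff_smul)

/-- The sum `∑_{l ≥ 0} x ^ l / l!`. -/
def expSum (x : ℝ≥0∞) : ℝ≥0∞ := ∑' l : ℕ, (l ! : ℝ≥0∞)⁻¹ * x ^ l

/-- The sum `∑_{l ≥ 1} x ^ l / l!`. -/
def expPosSum (x : ℝ≥0∞) : ℝ≥0∞ := ∑' l : ℕ, ((l + 1)! : ℝ≥0∞)⁻¹ * x ^ (l + 1)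

/-- The sum `∑_{l ≥ 1} x ^ l / l`. -/
def logSum (x : ℝ≥0∞) : ℝ≥0∞ := ∑' l : ℕ+, (l : ℝ≥0∞)⁻¹ * x ^ (l : ℕ)

/-- The series `exp F - 1`. -/
def expPos (F : ProfileSeries) : ProfileSeries :=
  sum fun l : ℕ => ((l + 1)! : ℝ≥0∞)⁻¹ • F ^ (l + 1)

theorem total_expPos (F : ProfileSeries) : total (expPos F) = expPosSum (total F) := by
  simp only [expPos, total_sum, total_smul, total_pow, expPosSum]

theorem expPos_zero : expPos 0 = 0 := by
  ext n
  simp [expPos, coeff_sum]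

theorem expSum_eq_one_add (x : ℝ≥0∞) : expSum x = 1 + expPosSum x := by
  rw [expSum, tsum_eq_zero_add' ENNReal.summable]
  simp [expPosSum]

theorem le_expPosSum (x : ℝ≥0∞) : x ≤ expPosSum x := by
  refine le_trans ?_ (ENNReal.le_tsum 0)
  simp

theorem expSum_ne_zero (x : ℝ≥0∞) : expSum x ≠ 0 := by
  rw [expSum_eq_one_add]
  simp

theorem ne_top_of_expSum_ne_top {x : ℝ≥0∞} (h : expSum x ≠ ∞) : x ≠ ∞ := by
  rw [expSum_eq_one_add] at h
  exact ne_top_of_le_ne_top (ENNReal.add_ne_top.1 h).2 (le_expPosSum x)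

theorem expSum_eq_ofReal {x : ℝ≥0∞} (hx : x ≠ ∞) :
    expSum x = ENNReal.ofReal (Real.exp x.toReal) := by
  have hs := NormedSpace.expSeries_div_hasSum_exp (𝔸 := ℝ) x.toReal
  rw [← Real.exp_eq_exp_ℝ] at hs
  rw [← hs.tsum_eq, ENNReal.ofReal_tsum_of_nonneg (fun l => by positivity) hs.summable]
  refine tsum_congr fun l => ?_
  rw [ENNReal.ofReal_div_of_pos (by positivity), ENNReal.ofReal_pow ENNReal.toReal_nonneg,
    ENNReal.ofReal_toReal hx, ENNReal.ofReal_natCast, div_eq_mul_inv, mul_comm]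

theorem expSum_ne_top {x : ℝ≥0∞} (hx : x ≠ ∞) : expSum x ≠ ∞ := by
  rw [expSum_eq_ofReal hx]
  exact ENNReal.ofReal_ne_top

theorem expPosSum_ne_top {x : ℝ≥0∞} (hx : x ≠ ∞) : expPosSum x ≠ ∞ := by
  have := expSum_ne_top hx
  rw [expSum_eq_one_add] at this
  exact (ENNReal.add_ne_top.1 this).2

theorem expSum_toReal {x : ℝ≥0∞} (hx : x ≠ ∞) : (expSum x).toReal = Real.exp x.toReal := by
  rw [expSum_eq_ofReal hx, ENNReal.toReal_ofReal (Real.exp_pos _).le]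

theorem expPosSum_toReal {x : ℝ≥0∞} (hx : x ≠ ∞) :
    (expPosSum x).toReal = Real.exp x.toReal - 1 := by
  rw [← expSum_toReal hx, expSum_eq_one_add,
    ENNReal.toReal_add ENNReal.one_ne_top (expPosSum_ne_top hx)]
  simp

theorem expSum_sum {α : Type*} (t : Finset α) {x : α → ℝ≥0∞} (hx : ∀ a, x a ≠ ∞) :
    expSum (∑ a ∈ t, x a) = ∏ a ∈ t, expSum (x a) := by
  rw [expSum_eq_ofReal (ENNReal.sum_ne_top.2 fun a _ => hx a), ENNReal.toReal_sum fun a _ => hx a,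
    Real.exp_sum, ENNReal.ofReal_prod_of_nonneg fun a _ => (Real.exp_pos _).le]
  exact Finset.prod_congr rfl fun a _ => (expSum_eq_ofReal (hx a)).symm

theorem exp_finset_sum {α : Type*} (t : Finset α) (Y : α → ProfileSeries) :
    exp (∑ a ∈ t, Y a) = ∏ a ∈ t, exp (Y a) := by
  classical
  induction t using Finset.induction_on with
  | empty => rw [Finset.sum_empty, Finset.prod_empty, exp_zero]
  | insert a t ha ih => rw [Finset.sum_insert ha, Finset.prod_insert ha, exp_add, ih]

/-- For x ≥ 1 the sum dominates the harmonic series. Finiteness of the value of a cycle class thus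
puts the argument in the domain of the logarithmic law. -/
theorem lt_one_of_logSum_ne_top {x : ℝ≥0∞} (h : logSum x ≠ ∞) : x < 1 := by
  by_contra hx
  rw [not_lt] at hx
  have h1 : ∑' l : ℕ, ((l + 1 : ℕ) : ℝ≥0∞)⁻¹ ≠ ∞ := by
    refine ne_top_of_le_ne_top h ?_
    rw [logSum, ← Equiv.pnatEquivNat.symm.tsum_eq]
    refine ENNReal.tsum_le_tsum fun l => ?_
    exact le_mul_of_one_le_right' (one_le_pow₀ hx)
  have h2 := ENNReal.summable_toReal h1
  have h3 : Summable fun l : ℕ => ((l + 1 : ℕ) : ℝ)⁻¹ := by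
    refine h2.congr fun l => ?_
    rw [ENNReal.toReal_inv, ENNReal.toReal_natCast]
  exact Real.not_summable_natCast_inv ((summable_nat_add_iff 1).1 h3)

theorem logSum_eq_ofReal {x : ℝ≥0∞} (hx : x < 1) :
    logSum x = ENNReal.ofReal (-Real.log (1 - x.toReal)) := by
  have hfin := (hx.trans ENNReal.one_lt_top).ne
  have hx1 : x.toReal < 1 := by
    rw [← ENNReal.toReal_one]
    exact (ENNReal.toReal_lt_toReal hfin ENNReal.one_ne_top).2 hx
  have hs := Real.hasSum_pow_div_log_of_abs_lt_one (x := x.toReal)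
    (by rwa [abs_of_nonneg ENNReal.toReal_nonneg])
  rw [← hs.tsum_eq, ENNReal.ofReal_tsum_of_nonneg _ hs.summable, logSum,
    ← Equiv.pnatEquivNat.symm.tsum_eq]
  · refine tsum_congr fun l => ?_
    rw [ENNReal.ofReal_div_of_pos (by positivity), ENNReal.ofReal_pow ENNReal.toReal_nonneg,
      ENNReal.ofReal_toReal hfin, div_eq_mul_inv, mul_comm]
    congr 2
    have : ((l : ℝ) + 1) = ((l + 1 : ℕ) : ℝ) := by push_cast; rfl
    rw [this, ENNReal.ofReal_natCast]
    rfl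
  · intro l
    have : (0 : ℝ) ≤ x.toReal := ENNReal.toReal_nonneg
    positivity

theorem logSum_toReal {x : ℝ≥0∞} (hx : x < 1) :
    (logSum x).toReal = -Real.log (1 - x.toReal) := by
  rw [logSum_eq_ofReal hx, ENNReal.toReal_ofReal]
  have h1 : x.toReal < 1 := by
    rw [← ENNReal.toReal_one]
    exact (ENNReal.toReal_lt_toReal (hx.trans ENNReal.one_lt_top).ne ENNReal.one_ne_top).2 hx
  exact neg_nonneg.2 (Real.log_nonpos (by linarith)
    (by linarith [ENNReal.toReal_nonneg (a := x)]))

theorem le_logSum (x : ℝ≥0∞) : x ≤ logSum x := by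
  refine le_trans ?_ (ENNReal.le_tsum 1)
  simp

theorem sum_succPNat (f : ℕ+ → ProfileSeries) : sum f = sum fun m : ℕ => f m.succPNat := by
  ext n
  rw [coeff_sum, coeff_sum, ← Equiv.pnatEquivNat.symm.tsum_eq]
  rfl

theorem smul_exp_eq_sum (x : ℝ≥0∞) (G : ProfileSeries) :
    (x • G).exp = sum fun q : ℕ => ((q ! : ℝ≥0∞)⁻¹ * x ^ q) • G ^ q := by
  simp only [exp, smul_pow, smul_smul]

/-- The increments of the partial products of `exp (∑ Y j)`. -/
def expIncrement (Y : ℕ → ProfileSeries) : ℕ → ProfileSeries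
  | 0 => exp (Y 0)
  | m + 1 => exp (∑ j ∈ Finset.range (m + 1), Y j) * expPos (Y (m + 1))

/-- The partial sums telescope, since exp(S + Y) = exp(S) + exp(S) (exp(Y) - 1), and the exponential
commutes with the increasing limit of the partial sums of `Y`. -/
theorem sum_expIncrement (Y : ℕ → ProfileSeries) : sum (expIncrement Y) = exp (sum Y) := by
  have h : ∀ N, ∑ j ∈ Finset.range (N + 1), expIncrement Y j =
      exp (∑ j ∈ Finset.range (N + 1), Y j) := by
    intro N
    induction N with
    | zero => simp [expIncrement]
    | succ N ih =>
      rw [Finset.sum_range_succ, ih, expIncrement, Finset.sum_range_succ _ (N + 1),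
        exp_add _ (Y (N + 1)), exp_eq_one_add (Y (N + 1)), mul_add, mul_one, expPos]
  have h1 := (IsMonoSup.sum_range (expIncrement Y)).succ
  simp only [h] at h1
  exact h1.unique (IsMonoSup.sum_range Y).succ.exp

/-- The increments of the partial products of `exp (∑ x j)`. -/
def expSumIncrement (x : ℕ → ℝ≥0∞) : ℕ → ℝ≥0∞
  | 0 => expSum (x 0)
  | m + 1 => expSum (∑ j ∈ Finset.range (m + 1), x j) * expPosSum (x (m + 1))

theorem tsum_expSumIncrement (x : ℕ → ℝ≥0∞) :
    ∑' m, expSumIncrement x m = expSum (∑' m, x m) := by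
  -- The numerical identity is the one for series, applied to constant series.
  have h := congrArg total (sum_expIncrement fun m => monomial 0 (x m))
  rw [total_sum, total_exp, total_sum] at h
  simp only [total_monomial] at h
  rw [expSum, ← h]
  refine tsum_congr fun m => ?_
  cases m with
  | zero => rw [expIncrement, total_exp, total_monomial, expSumIncrement, expSum]
  | succ m =>
    rw [expIncrement, total_mul, total_exp, total_expPos, total_monomial, expSumIncrement, expSum,
      ← map_sum, total_monomial]

end ProfileSeries

/-! ### The elementary laws -/

open ProfileSeries

namespace Gen

open MvPowerSeries (coeff monomial coeff_smul)

theorem mass_draw_geomLaw {x : ℝ≥0∞} (hx : x < 1) (k : ℕ) :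
    mass (draw (geomLaw x.toReal)) k = x ^ k * (1 - x) := by
  refine mass_draw (q := fun k => x ^ k * (1 - x)) (fun k => ?_) ?_ k
  · rw [geomLaw, ENNReal.toReal_mul, ENNReal.toReal_pow,
      ENNReal.toReal_sub_of_le hx.le ENNReal.one_ne_top, ENNReal.toReal_one]
  · rw [ENNReal.tsum_mul_right, ENNReal.tsum_geometric, ENNReal.inv_mul_cancel]
    · exact (tsub_pos_of_lt hx).ne'
    · exact ENNReal.sub_ne_top ENNReal.one_ne_top

theorem mass_draw_poissonLaw {x : ℝ≥0∞} (hx : x ≠ ∞) (q : ℕ) :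
    mass (draw (poissonLaw x.toReal)) q = (expSum x)⁻¹ * ((q ! : ℝ≥0∞)⁻¹ * x ^ q) := by
  refine mass_draw (q := fun q => (expSum x)⁻¹ * ((q ! : ℝ≥0∞)⁻¹ * x ^ q)) (fun q => ?_) ?_ q
  · rw [poissonLaw, ENNReal.toReal_mul, ENNReal.toReal_mul, ENNReal.toReal_pow, ENNReal.toReal_inv,
      ENNReal.toReal_inv, expSum_toReal hx, ENNReal.toReal_natCast, Real.exp_neg]
    ring
  · rw [ENNReal.tsum_mul_left]
    exact ENNReal.inv_mul_cancel (expSum_ne_zero x) (expSum_ne_top hx)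

theorem mass_draw_posPoissonLaw {x : ℝ≥0∞} (h0 : x ≠ 0) (hx : x ≠ ∞) (q : ℕ) :
    mass (draw (posPoissonLaw x.toReal)) q =
      if q = 0 then 0 else (expPosSum x)⁻¹ * ((q ! : ℝ≥0∞)⁻¹ * x ^ q) := by
  refine mass_draw (q := fun q => if q = 0 then 0 else
    (expPosSum x)⁻¹ * ((q ! : ℝ≥0∞)⁻¹ * x ^ q)) (fun q => ?_) ?_ q
  · rw [posPoissonLaw]
    split_ifs
    · simp
    · rw [ENNReal.toReal_mul, ENNReal.toReal_mul, ENNReal.toReal_pow, ENNReal.toReal_inv,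
        ENNReal.toReal_inv, expPosSum_toReal hx, ENNReal.toReal_natCast]
      ring
  · rw [tsum_eq_zero_add' ENNReal.summable]
    simp only [if_true, Nat.add_eq_zero_iff, one_ne_zero, and_false, if_false, zero_add]
    rw [ENNReal.tsum_mul_left]
    exact ENNReal.inv_mul_cancel
      (fun h => h0 (le_antisymm (h ▸ le_expPosSum x) zero_le)) (expPosSum_ne_top hx)

theorem mass_draw_logLaw {x : ℝ≥0∞} (h0 : x ≠ 0) (hx : x < 1) (l : ℕ+) :
    mass (draw (logLaw x.toReal)) l = (logSum x)⁻¹ * ((l : ℝ≥0∞)⁻¹ * x ^ (l : ℕ)) := by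
  refine mass_draw (q := fun l : ℕ+ => (logSum x)⁻¹ * ((l : ℝ≥0∞)⁻¹ * x ^ (l : ℕ)))
    (fun l => ?_) ?_ l
  · rw [logLaw, ENNReal.toReal_mul, ENNReal.toReal_mul, ENNReal.toReal_pow, ENNReal.toReal_inv,
      ENNReal.toReal_inv, logSum_toReal hx, ENNReal.toReal_natCast, inv_neg]
    ring
  · rw [ENNReal.tsum_mul_left]
    refine ENNReal.inv_mul_cancel (fun h => h0 (le_antisymm (h ▸ le_logSum x) zero_le)) ?_
    rw [logSum_eq_ofReal hx]
    exact ENNReal.ofReal_ne_top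

/-- The tail product is the exponential of minus the tail sum, and the tail is the whole sum minus
its first `m + 1` terms. -/
theorem maxIndexCdf_succPNat {x : ℕ+ → ℝ} (hx : Summable x) (m : ℕ) :
    maxIndexCdf x m.succPNat =
      Real.exp (∑ j ∈ Finset.range (m + 1), x j.succPNat) / Real.exp (∑' j, x j) := by
  have hcompl : ((Set.Ioi m.succPNat) : Set ℕ+) =
      {j | j ∉ (Finset.range (m + 1)).image Nat.succPNat} := by
    ext j
    obtain ⟨i, rfl⟩ : ∃ i, j = Nat.succPNat i := ⟨j.natPred, (PNat.succPNat_natPred j).symm⟩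
    simp only [Set.mem_Ioi, ← PNat.coe_lt_coe, Nat.succPNat_coe, Set.mem_ofPred_eq, Finset.mem_image,
      Finset.mem_range, Nat.succPNat_injective.eq_iff, exists_eq_right]
    omega
  have hlog : (fun j : Set.Ioi m.succPNat => Real.log (Real.exp (-x j))) =
      fun j : Set.Ioi m.succPNat => -x j := by
    funext j
    exact Real.log_exp _
  have hsub : Summable fun j : Set.Ioi m.succPNat => x j := hx.subtype _
  rw [maxIndexCdf, ← Real.rexp_tsum_eq_tprod (fun j => Real.exp_pos _) (by rw [hlog]; exact hsub.neg),
    hlog, tsum_neg, ← Real.exp_sub]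
  congr 1
  have h1 := hx.sum_add_tsum_subtype_compl ((Finset.range (m + 1)).image Nat.succPNat)
  rw [Finset.sum_image fun _ _ _ _ h => Nat.succPNat_injective h] at h1
  rw [hcompl, ← h1]
  change -(∑' j : {j // j ∉ (Finset.range (m + 1)).image Nat.succPNat}, x j) = _
  ring

/-- With T the whole sum and S the sum of the terms before x, consecutive values of the distribution
function differ by (exp(S + x) - exp(S)) / exp(T), an increment of the telescoping sum divided by
the normalizer. -/
theorem maxIndexLaw_succPNat {x : ℕ+ → ℝ≥0∞} (hx : ∑' j, x j ≠ ∞) (m : ℕ) :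
    maxIndexLaw (fun j => (x j).toReal) m.succPNat = ((expSum (∑' j, x j))⁻¹ *
      expSumIncrement (fun j => x j.succPNat) m).toReal := by
  have hfin := ENNReal.ne_top_of_tsum_ne_top hx
  have hs := ENNReal.summable_toReal hx
  rw [ENNReal.toReal_mul, ENNReal.toReal_inv, expSum_toReal hx, ENNReal.tsum_toReal_eq hfin]
  cases m with
  | zero =>
    rw [maxIndexLaw, if_pos (show Nat.succPNat 0 = 1 from rfl), expSumIncrement, expSum_toReal (hfin _)]
    have := maxIndexCdf_succPNat hs 0
    rw [Finset.sum_range_one] at this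
    rw [inv_mul_eq_div]
    exact this
  | succ m =>
    have h1 : (m + 1).succPNat ≠ 1 := by
      intro h
      have := congrArg PNat.val h
      simp at this
    have h2 : (m + 1).succPNat - 1 = m.succPNat := by
      rw [← PNat.coe_inj, PNat.sub_coe, if_pos (lt_of_le_of_ne (one_le) h1.symm)]
      simp
    rw [maxIndexLaw, if_neg h1, h2, maxIndexCdf_succPNat hs, maxIndexCdf_succPNat hs,
      expSumIncrement, ENNReal.toReal_mul, expPosSum_toReal (hfin _),
      expSum_toReal (ENNReal.sum_ne_top.2 fun j _ => hfin _),
      ENNReal.toReal_sum fun j _ => hfin _, Finset.sum_range_succ _ (m + 1), Real.exp_add]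
    ring

theorem mass_draw_maxIndexLaw {x : ℕ+ → ℝ≥0∞} (hx : ∑' j, x j ≠ ∞) (m : ℕ) :
    mass (draw (maxIndexLaw fun j => (x j).toReal)) m.succPNat =
      (expSum (∑' j, x j))⁻¹ * expSumIncrement (fun j => x j.succPNat) m := by
  have h := mass_draw (p := maxIndexLaw fun j => (x j).toReal)
    (q := fun k => (expSum (∑' j, x j))⁻¹ * expSumIncrement (fun j => x j.succPNat) k.natPred)
    (fun k => ?_) ?_ m.succPNat
  · rwa [Nat.natPred_succPNat] at h
  · conv_lhs => rw [← PNat.succPNat_natPred k]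
    exact maxIndexLaw_succPNat hx _
  · have h1 : ∑' k : ℕ+, expSumIncrement (fun j => x j.succPNat) k.natPred =
        ∑' m, expSumIncrement (fun j => x j.succPNat) m :=
      Equiv.pnatEquivNat.tsum_eq (expSumIncrement fun j => x j.succPNat)
    have h2 : ∑' m : ℕ, x m.succPNat = ∑' j, x j := Equiv.pnatEquivNat.symm.tsum_eq x
    rw [ENNReal.tsum_mul_left, h1, tsum_expSumIncrement, h2]
    exact ENNReal.inv_mul_cancel (expSum_ne_zero _) (expSum_ne_top hx)

/-! ### Random numbers of independent words -/

/-- In the application `G` is the profile series of the argument's sampler and `x` the value of the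
argument, so `x • G` is the rescaled generating function; the power of `x` in the law turns powers
of `G` into powers of `x • G`. -/
theorem sum_mass_draw_geomLaw {x : ℝ≥0∞} (hx : x < 1) (G : ProfileSeries) :
    (sum fun k => mass (draw (geomLaw x.toReal)) k • G ^ k) = (1 - x) • (x • G).geom := by
  simp only [mass_draw_geomLaw hx, geom, smul_sum, smul_pow, smul_smul, mul_comm]

theorem sum_mass_draw_poissonLaw {x : ℝ≥0∞} (hx : x ≠ ∞) (G : ProfileSeries) :
    (sum fun q => mass (draw (poissonLaw x.toReal)) q • G ^ q) = (expSum x)⁻¹ • (x • G).exp := by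
  simp only [mass_draw_poissonLaw hx, smul_exp_eq_sum, smul_sum, smul_smul]

theorem sum_mass_draw_posPoissonLaw {x : ℝ≥0∞} (h0 : x ≠ 0) (hx : x ≠ ∞) (G : ProfileSeries) :
    (sum fun q => mass (draw (posPoissonLaw x.toReal)) q • G ^ q) =
      (expPosSum x)⁻¹ • (x • G).expPos := by
  ext n
  rw [coeff_sum, tsum_eq_zero_add' ENNReal.summable]
  simp only [mass_draw_posPoissonLaw h0 hx, if_true, Nat.add_eq_zero_iff, one_ne_zero, and_false,
    if_false, zero_smul, map_zero, zero_add, expPos, smul_sum, smul_pow, smul_smul, coeff_sum]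

theorem sum_mass_draw_logLaw {x : ℝ≥0∞} (h0 : x ≠ 0) (hx : x < 1) (G : ProfileSeries) :
    (sum fun l : ℕ+ => mass (draw (logLaw x.toReal)) l • G ^ (l : ℕ)) =
      (logSum x)⁻¹ • (x • G).negLog := by
  simp only [mass_draw_logLaw h0 hx, negLog, smul_sum, smul_pow, smul_smul]

end Gen

end

noncomputable section

open ProfileSeries

-- Samplers of sequences, multisets and cycles

namespace Gen

open MvPowerSeries (coeff monomial coeff_smul)

theorem series_draw_repeatConcat_nil (p : ℕ → ℝ) (g : Gen ProfiledWord)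
    {c : ProfiledWord → ProfiledWord} (hc : ∀ w, (c w).profile = w.profile) :
    series (draw p >>= fun q => repeatConcat g q [] >>= fun S => pure (c S)) =
      sum fun q => mass (draw p) q • series g ^ q := by
  rw [series_bind]
  simp only [series_bind_pure _ hc, series_repeatConcat, ProfiledWord.profile_nil]
  simp only [MvPowerSeries.monomial_zero_one, one_mul]

theorem series_seqSampler {x : ℝ≥0∞} (hx : x < 1) (g : Gen ProfiledWord) :
    series (draw (geomLaw x.toReal) >>= fun k => repeatConcat g k [] >>= fun S =>
      pure [.paren S]) = (1 - x) • (x • series g).geom := by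
  rw [series_draw_repeatConcat_nil _ _ ProfiledWord.profile_paren, sum_mass_draw_geomLaw hx]

theorem series_poissonLoop_poissonLaw {x : ℕ+ → ℝ≥0∞} (hx : ∀ j, x j ≠ ∞)
    (g : ℕ+ → Gen ProfiledWord) (m : ℕ) :
    series (poissonLoop (fun j => (x j).toReal) g m []) =
      (expSum (∑ j ∈ Finset.range m, x j.succPNat))⁻¹ •
        exp (∑ j ∈ Finset.range m, x j.succPNat • series (g j.succPNat)) := by
  rw [series_poissonLoop, ProfiledWord.profile_nil, MvPowerSeries.monomial_zero_one, one_mul,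
    expSum_sum _ fun j => hx _, exp_finset_sum,
    ENNReal.prod_inv_distrib fun _ _ _ _ _ => Or.inl (expSum_ne_zero _), ← Finset.prod_smul]
  exact Finset.prod_congr rfl fun j _ => sum_mass_draw_poissonLaw (hx _) _

/-- The branch `k` of the sampler produces the `k`-th term of the telescoping sum for the
exponential. The program `h` is separate from `g 1` because the branch `k = 1` does not apply the
diagonal δ₁. -/
theorem series_msetSampler {x : ℕ+ → ℝ≥0∞} (hx : ∑' j, x j ≠ ∞) (g : ℕ+ → Gen ProfiledWord)
    (h : Gen ProfiledWord) (hg : series h = series (g 1)) :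
    series (draw (maxIndexLaw fun j => (x j).toReal) >>= fun k =>
      if k = 1 then
        draw (poissonLaw (x 1).toReal) >>= fun q => repeatConcat h q [] >>= fun S =>
          pure [.brace S]
      else
        poissonLoop (fun j => (x j).toReal) g ((k : ℕ) - 1) [] >>= fun S =>
          draw (posPoissonLaw (x k).toReal) >>= fun q => repeatConcat (g k) q S >>= fun S =>
            pure [.brace S]) =
      (expSum (∑' j, x j))⁻¹ • exp (sum fun j => x j • series (g j)) := by
  have hfin := ENNReal.ne_top_of_tsum_ne_top hx
  rw [series_bind, sum_succPNat, sum_succPNat fun j => x j • series (g j), ← sum_expIncrement,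
    smul_sum]
  refine congrArg sum (funext fun m => ?_)
  rw [mass_draw_maxIndexLaw hx, mul_smul]
  -- The common normalizer is removed; what remains is that the probability weight of the branch
  -- cancels the normalizers of the Poisson laws drawn in it.
  congr 1
  cases m with
  | zero =>
    rw [if_pos (show Nat.succPNat 0 = 1 from rfl),
      series_draw_repeatConcat_nil _ _ ProfiledWord.profile_brace,
      sum_mass_draw_poissonLaw (hfin 1), hg, expSumIncrement, expIncrement, smul_smul]
    exact (congrArg (· • _) (ENNReal.mul_inv_cancel (expSum_ne_zero (x 1))
      (expSum_ne_top (hfin 1)))).trans (one_smul _ _)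
  | succ m =>
    have h1 : (m + 1).succPNat ≠ 1 := by
      intro h
      have := congrArg PNat.val h
      simp at this
    rw [if_neg h1, expSumIncrement, expIncrement]
    -- If the parameter is 0, the conditioned Poisson law does not exist, but this branch has
    -- probability 0.
    by_cases h0 : x (m + 1).succPNat = 0
    · rw [h0, zero_smul, expPos_zero, mul_zero]
      simp [expPosSum]
    · rw [series_bind_mul (H := sum fun q =>
          mass (draw (posPoissonLaw (x (m + 1).succPNat).toReal)) q •
            series (g (m + 1).succPNat) ^ q), sum_mass_draw_posPoissonLaw h0 (hfin _),
        Nat.succPNat_coe, Nat.succ_sub_one, series_poissonLoop_poissonLaw hfin, smul_mul_smul_comm,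
        smul_smul, mul_mul_mul_comm, ENNReal.mul_inv_cancel (expSum_ne_zero _),
        ENNReal.mul_inv_cancel, one_mul, one_smul]
      · exact fun h => h0 (le_antisymm (h ▸ le_expPosSum _) zero_le)
      · exact expPosSum_ne_top (hfin _)
      · exact expSum_ne_top (ENNReal.sum_ne_top.2 fun j _ => hfin _)
      · intro S
        rw [series_bind, ProfileSeries.mul_sum]
        simp only [series_bind_pure _ ProfiledWord.profile_brace, series_repeatConcat,
          mul_smul_comm]

theorem series_cycSampler {x c : ℕ+ → ℝ≥0∞} (hc : ∀ k, c k ≠ 0)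
    (h0 : ∑' k, c k * logSum (x k) ≠ 0) (hx : ∑' k, c k * logSum (x k) ≠ ∞)
    {p : ℕ+ → ℝ} (hp : ∀ k, p k =
      -(1 / (∑' k, c k * logSum (x k)).toReal) * (c k).toReal * Real.log (1 - (x k).toReal))
    (g : ℕ+ → Gen ProfiledWord) :
    series (draw p >>= fun k => draw (logLaw (x k).toReal) >>= fun l : ℕ+ =>
      repeatConcat (g k) (l : ℕ) [] >>= fun M => pure [.bracket (M.diag k)]) =
      (∑' k, c k * logSum (x k))⁻¹ • sum fun k => c k • ((x k • series (g k)).diag k).negLog := by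
  -- Since `c k` is nonzero, a finite weighted sum forces each logarithmic sum to be finite.
  have hlt : ∀ k, x k < 1 := fun k => by
    refine lt_one_of_logSum_ne_top fun h => ENNReal.ne_top_of_tsum_ne_top hx k ?_
    rw [h, ENNReal.mul_top (hc k)]
  have hm : ∀ k, mass (draw p) k = (∑' k, c k * logSum (x k))⁻¹ * (c k * logSum (x k)) := by
    refine mass_draw (q := fun k => (∑' k, c k * logSum (x k))⁻¹ * (c k * logSum (x k)))
      (fun k => ?_) ?_
    · rw [hp, ENNReal.toReal_mul, ENNReal.toReal_mul, ENNReal.toReal_inv, logSum_toReal (hlt k)]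
      ring
    · rw [ENNReal.tsum_mul_left]
      exact ENNReal.inv_mul_cancel h0 hx
  rw [series_bind, smul_sum]
  refine congrArg sum (funext fun k => ?_)
  rw [hm, mul_smul, mul_smul]
  congr 2
  -- The logarithmic law is undefined at 0, but such a `k` is drawn with probability 0.
  by_cases hk : x k = 0
  · have h1 : logSum 0 = 0 := by simp [logSum]
    have h2 : ProfileSeries.diag k 0 = 0 := by
      have := ProfileSeries.diag_smul k 0 0
      rwa [zero_smul, zero_smul] at this
    rw [hk, h1, zero_smul, zero_smul, h2, negLog]
    ext n
    simp [coeff_sum]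
  · have h1 : logSum (x k) ≠ 0 := fun h => hk (le_antisymm (h ▸ le_logSum _) zero_le)
    have h2 : logSum (x k) ≠ ∞ := by
      rw [logSum_eq_ofReal (hlt k)]
      exact ENNReal.ofReal_ne_top
    have h3 : ∀ (l : ℕ), series (repeatConcat (g k) l [] >>= fun M =>
        pure [.bracket (M.diag k)]) = (series (g k)).diag k ^ l := by
      intro l
      rw [series_bind_diag k _ fun w => ProfiledWord.profile_bracket _, series_repeatConcat,
        ProfiledWord.profile_nil, MvPowerSeries.monomial_zero_one, one_mul, diag_pow]
    rw [series_bind]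
    simp only [h3]
    rw [sum_mass_draw_logLaw hk (hlt k), smul_smul, ENNReal.mul_inv_cancel h1 h2, one_smul,
      ProfileSeries.diag_smul]

end Gen

-- Values of the generating functions and the law at bounded recursion depth

namespace Spec

open MvPowerSeries (coeff monomial coeff_smul)

open Gen (series mass)

variable {ι : Type*} {E : ι → Spec ι} {s : ℕ+ → ℝ≥0}

theorem eval_neutral : (neutral.genFun E).eval s = 1 := by
  rw [genFun, genFunOf, eval_eq_total, scale_one, total_one]

theorem eval_sum (A B : Spec ι) :
    ((sum A B).genFun E).eval s = (A.genFun E).eval s + (B.genFun E).eval s := by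
  rw [genFun, genFunOf, eval_eq_total, scale_add, total_add]
  rfl

theorem eval_prod (A B : Spec ι) :
    ((prod A B).genFun E).eval s = (A.genFun E).eval s * (B.genFun E).eval s := by
  rw [genFun, genFunOf, eval_eq_total, scale_mul, total_mul]
  rfl

theorem eval_diag (k : ℕ+) (A : Spec ι) :
    ((diag k A).genFun E).eval s = (A.genFun E).eval (dilate k s) := by
  rw [genFun, genFunOf, eval_eq_total, scale_diag, total_diag]
  rfl

theorem eval_seq (A : Spec ι) :
    ((seq A).genFun E).eval s = (1 - (A.genFun E).eval s)⁻¹ := by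
  rw [genFun, genFunOf, eval_eq_total, scale_geom, total_geom]
  rfl

theorem eval_mset (A : Spec ι) : ((mset A).genFun E).eval s =
    expSum (∑' k : ℕ+, (k : ℝ≥0∞)⁻¹ * (A.genFun E).eval (dilate k s)) := by
  rw [genFun, genFunOf, eval_eq_total, scale_exp, total_exp, scale_sum, total_sum]
  simp only [scale_smul, total_smul, scale_diag, total_diag]
  rfl

theorem eval_cyc (A : Spec ι) : ((cyc A).genFun E).eval s =
    ∑' k : ℕ+, (φ (k : ℕ) : ℝ≥0∞) / (k : ℝ≥0∞) * logSum ((A.genFun E).eval (dilate k s)) := by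
  rw [genFun, genFunOf, eval_eq_total, scale_sum, total_sum]
  simp only [scale_smul, total_smul, scale_negLog, total_negLog, scale_diag, total_diag]
  rfl

theorem dilate_one (s : ℕ+ → ℝ≥0) : dilate 1 s = s := by
  funext i
  rw [dilate, one_mul]

/-- A vanishing sum in [0, ∞] has only zero terms. This settles the subexpressions of value 0, whose
samplers may contain meaningless draws. -/
theorem scale_eq_zero {F G : ProfileSeries} (h : ∀ n, coeff n F ≤ coeff n G)
    (h0 : G.eval s = 0) : F.scale s = 0 := by
  ext n
  rw [coeff_scale]
  have h1 := ENNReal.tsum_eq_zero.1 h0 n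
  exact le_antisymm ((mul_le_mul_left (h n) _).trans h1.le) zero_le

/-- The profile of the output of the sampler of `A` has the law given by the generating function
of `A`, if this holds for the variables. -/
theorem eval_smul_series_samplerOf {T : ι → ProfileSeries}
    {call : ι → (ℕ+ → ℝ≥0) → Gen ProfiledWord}
    (hT : ∀ i n, coeff n (T i) ≤ coeff n (solution E i))
    (hcall : ∀ i s, (solution E i).eval s ≠ ∞ →
      (solution E i).eval s • series (call i s) = (T i).scale s)
    (A : Spec ι) (s : ℕ+ → ℝ≥0) (hfin : (A.genFun E).eval s ≠ ∞) :
    (A.genFun E).eval s • series (A.samplerOf E call s) = (A.genFunOf T).scale s := by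
  by_cases h0 : (A.genFun E).eval s = 0
  · rw [h0, zero_smul, scale_eq_zero (genFunOf_mono hT A) h0]
  induction A generalizing s with
  | neutral =>
    rw [eval_neutral, one_smul, samplerOf, Gen.series_pure, genFunOf, scale_one]
    rfl
  | atom =>
    have h : scale s (MvPowerSeries.X 1 : ProfileSeries) =
        monomialValue s (Finsupp.single 1 1) • monomial (Finsupp.single 1 1) 1 :=
      scale_monomial s _
    rw [samplerOf, Gen.series_pure, ProfiledWord.profile_atom, genFunOf, h, genFun, genFunOf,
      eval_eq_total, h, total_smul, total_monomial, mul_one]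
  | var i => exact hcall i s hfin
  | sum A B hA hB =>
    have hA' : (A.genFun E).eval s ≠ ∞ := by
      rw [eval_sum] at hfin
      exact (ENNReal.add_ne_top.1 hfin).1
    have hB' : (B.genFun E).eval s ≠ ∞ := by
      rw [eval_sum] at hfin
      exact (ENNReal.add_ne_top.1 hfin).2
    -- The induction hypothesis covers nonzero values only; at value 0 both sides vanish.
    have ihA : (A.genFun E).eval s • series (A.samplerOf E call s) = (A.genFunOf T).scale s := by
      by_cases h : (A.genFun E).eval s = 0
      · rw [h, zero_smul, scale_eq_zero (genFunOf_mono hT A) h]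
      · exact hA s hA' h
    have ihB : (B.genFun E).eval s • series (B.samplerOf E call s) = (B.genFunOf T).scale s := by
      by_cases h : (B.genFun E).eval s = 0
      · rw [h, zero_smul, scale_eq_zero (genFunOf_mono hT B) h]
      · exact hB s hB' h
    set V := ((sum A B).genFun E).eval s with hV
    have hsum : V = (A.genFun E).eval s + (B.genFun E).eval s := eval_sum A B
    have hm : ∀ b, mass (draw (bernoulliLaw (A.value E s / (sum A B).value E s))) b =
        V⁻¹ * if b then (A.genFun E).eval s else (B.genFun E).eval s := by
      refine Gen.mass_draw (q := fun b : Bool =>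
        V⁻¹ * if b then (A.genFun E).eval s else (B.genFun E).eval s) (fun b => ?_) ?_
      · have hVr : V.toReal ≠ 0 := ENNReal.toReal_ne_zero.2 ⟨h0, hfin⟩
        have hr : V.toReal = A.value E s + B.value E s := by
          rw [hsum, ENNReal.toReal_add hA' hB']
          rfl
        rw [ENNReal.toReal_mul, ENNReal.toReal_inv]
        cases b with
        | true => exact div_eq_inv_mul _ _
        | false =>
          change 1 - A.value E s / V.toReal = V.toReal⁻¹ * B.value E s
          field_simp
          rw [hr]
          ring
      · rw [ENNReal.tsum_mul_left, tsum_bool]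
        simp only [if_true, Bool.false_eq_true, if_false]
        rw [add_comm, ← hsum]
        exact ENNReal.inv_mul_cancel h0 hfin
    have hs : series ((sum A B).samplerOf E call s) =
        V⁻¹ • ((A.genFunOf T).scale s + (B.genFunOf T).scale s) := by
      rw [samplerOf, Gen.series_bind]
      simp only [hm]
      ext n
      rw [coeff_sum, tsum_bool, ← ihA, ← ihB]
      simp only [if_true, Bool.false_eq_true, if_false, coeff_smul, map_add]
      ring
    rw [hs, smul_smul, ENNReal.mul_inv_cancel h0 hfin, one_smul, genFunOf, scale_add]
  | prod A B hA hB =>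
    rw [eval_prod] at h0 hfin
    -- In [0, ∞], factors of a nonzero finite product are nonzero, and therefore finite.
    have hA0 := left_ne_zero_of_mul h0
    have hB0 := right_ne_zero_of_mul h0
    have ihA := hA s (fun h => hfin (by rw [h, ENNReal.top_mul hB0])) hA0
    have ihB := hB s (fun h => hfin (by rw [h, ENNReal.mul_top hA0])) hB0
    rw [eval_prod, samplerOf, genFunOf, scale_mul, ← ihA, ← ihB, smul_mul_smul_comm]
    congr 1
    refine Gen.series_bind_mul _ fun u => ?_
    rw [Gen.series_bind]
    simp only [Gen.series_pure, ProfiledWord.profile_paren, ProfiledWord.profile_concat]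
    conv_rhs => rw [series, mul_sum]
    simp only [mul_smul_comm, MvPowerSeries.monomial_mul_monomial, mul_one]
  | diag k A hA =>
    rw [eval_diag] at h0 hfin
    rw [eval_diag, samplerOf, Gen.series_bind_diag k _ fun w => rfl, ← ProfileSeries.diag_smul,
      hA _ hfin h0, genFunOf, scale_diag]
  | seq A hA =>
    have hlt : (A.genFun E).eval s < 1 := by
      -- Subtraction is truncated, so the value is infinite as soon as the argument reaches 1.
      rw [eval_seq, Ne, ENNReal.inv_eq_top] at hfin
      exact tsub_pos_iff_lt.1 (pos_iff_ne_zero.2 hfin)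
    have ih : (A.genFun E).eval s • series (A.samplerOf E call s) = (A.genFunOf T).scale s := by
      by_cases h : (A.genFun E).eval s = 0
      · rw [h, zero_smul, scale_eq_zero (genFunOf_mono hT A) h]
      · exact hA s (hlt.trans ENNReal.one_lt_top).ne h
    have hs : series ((seq A).samplerOf E call s) = _ := Gen.series_seqSampler hlt _
    rw [hs, ih, eval_seq, smul_smul, ENNReal.inv_mul_cancel (tsub_pos_of_lt hlt).ne'
      (ENNReal.sub_ne_top ENNReal.one_ne_top), one_smul, genFunOf, scale_geom]
  | mset A hA =>
    set x : ℕ+ → ℝ≥0∞ := fun k => (k : ℝ≥0∞)⁻¹ * (A.genFun E).eval (dilate k s) with hx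
    have hV : ((mset A).genFun E).eval s = expSum (∑' k, x k) := eval_mset A
    have hsum : ∑' k, x k ≠ ∞ := ne_top_of_expSum_ne_top (hV ▸ hfin)
    have hA' : ∀ k, (A.genFun E).eval (dilate k s) ≠ ∞ := fun k h => by
      refine ENNReal.ne_top_of_tsum_ne_top hsum k ?_
      rw [hx]
      simp only [h]
      exact ENNReal.mul_top (ENNReal.inv_ne_zero.2 (ENNReal.natCast_ne_top _))
    have ih : ∀ k, (A.genFun E).eval (dilate k s) • series (A.samplerOf E call (dilate k s)) =
        (A.genFunOf T).scale (dilate k s) := fun k => by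
      by_cases h : (A.genFun E).eval (dilate k s) = 0
      · rw [h, zero_smul, scale_eq_zero (genFunOf_mono hT A) h]
      · exact hA _ (hA' k) h
    have hxr : (fun j : ℕ+ => 1 / (j : ℝ) * A.value E (dilate j s)) = fun j => (x j).toReal := by
      funext j
      rw [ENNReal.toReal_mul, ENNReal.toReal_inv, ENNReal.toReal_natCast, one_div]
      rfl
    have hx1 : A.value E s = (x 1).toReal := by
      rw [← congrFun hxr 1, dilate_one]
      simp
    set g : ℕ+ → Gen ProfiledWord := fun j =>
      A.samplerOf E call (dilate j s) >>= fun w => pure (w.diag j) with hgdef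
    have hg : ∀ j, series (g j) = (series (A.samplerOf E call (dilate j s))).diag j :=
      fun j => Gen.series_bind_diag j _ fun w => rfl
    -- Both δ₁ and dilation by 1 are trivial, so the branch `k = 1` has the same series as `g 1`.
    have hg1 : series (A.samplerOf E call s) = series (g 1) := by
      refine (Gen.series_bind_pure _ (c := fun w => w.diag 1) fun w => ?_).symm.trans ?_
      · simp [ProfiledWord.diag]
      · rw [hgdef]
        simp only [dilate_one]
    have hs := Gen.series_msetSampler hsum g _ hg1
    rw [← hxr, ← hx1] at hs
    have hs' : series ((mset A).samplerOf E call s) =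
        (expSum (∑' j, x j))⁻¹ • exp (ProfileSeries.sum fun j => x j • series (g j)) := by
      rw [← hs, samplerOf]
      simp only [congrFun hxr]
      rfl
    rw [hs', hV, smul_smul, ENNReal.mul_inv_cancel (expSum_ne_zero _) (expSum_ne_top hsum),
      one_smul, genFunOf, scale_exp, scale_sum]
    congr 2
    funext j
    rw [scale_smul, scale_diag, ← ih, hg, hx, ProfileSeries.diag_smul, mul_smul]
  | cyc A hA =>
    have hV := eval_cyc (E := E) (s := s) A
    have hc : ∀ k : ℕ+, (φ (k : ℕ) : ℝ≥0∞) / (k : ℝ≥0∞) ≠ 0 := fun k =>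
      ENNReal.div_ne_zero.2 ⟨by exact_mod_cast (Nat.totient_pos.2 k.pos).ne',
        ENNReal.natCast_ne_top _⟩
    have hA' : ∀ k, (A.genFun E).eval (dilate k s) ≠ ∞ := fun k => by
      refine ((lt_one_of_logSum_ne_top fun h =>
        ENNReal.ne_top_of_tsum_ne_top (hV ▸ hfin) k ?_).trans ENNReal.one_lt_top).ne
      rw [h, ENNReal.mul_top (hc k)]
    have ih : ∀ k, (A.genFun E).eval (dilate k s) • series (A.samplerOf E call (dilate k s)) =
        (A.genFunOf T).scale (dilate k s) := fun k => by
      by_cases h : (A.genFun E).eval (dilate k s) = 0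
      · rw [h, zero_smul, scale_eq_zero (genFunOf_mono hT A) h]
      · exact hA _ (hA' k) h
    have hs : series ((cyc A).samplerOf E call s) = _ :=
      Gen.series_cycSampler (x := fun k => (A.genFun E).eval (dilate k s)) hc (hV ▸ h0)
        (hV ▸ hfin) (fun k => by
          rw [← hV, ENNReal.toReal_div, ENNReal.toReal_natCast, ENNReal.toReal_natCast]
          rfl) _
    rw [hs, ← hV, smul_smul, ENNReal.mul_inv_cancel h0 hfin, one_smul, genFunOf, scale_sum]
    congr 1
    funext k
    rw [scale_smul, scale_negLog, scale_diag, ih]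

/-- At depth 0 the run fails and the iterate is 0. One more call applies the equation on both sides,
and the fixed point property identifies the value of the variable with that of its right-hand side.
-/
theorem eval_smul_series_callSampler (N : ℕ) (i : ι) (s : ℕ+ → ℝ≥0)
    (hfin : (solution E i).eval s ≠ ∞) :
    (solution E i).eval s • series (callSampler E N i s) = (iterate E N i).scale s := by
  induction N generalizing i s with
  | zero =>
    rw [callSampler, Gen.series_failure, smul_zero]
    ext n
    exact (zero_mul _).symm
  | succ N ih =>
    rw [solution_eq] at hfin ⊢
    exact eval_smul_series_samplerOf (fun i n => (isMonoSup_iterate E i).le N n) ih (E i) s hfin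

end Spec

end

noncomputable section

/-! ### Monotonicity in the number of nested calls -/

namespace Gen

theorem mass_repeatConcat_mono {g g' : Gen ProfiledWord} (h : ∀ w, mass g w ≤ mass g' w) (q : ℕ)
    (S w : ProfiledWord) : mass (repeatConcat g q S) w ≤ mass (repeatConcat g' q S) w := by
  induction q generalizing S w with
  | zero => exact le_rfl
  | succ q ih => exact mass_bind_mono h (fun a => ih _) w

theorem mass_poissonLoop_mono (x : ℕ+ → ℝ) {g g' : ℕ+ → Gen ProfiledWord}
    (h : ∀ j w, mass (g j) w ≤ mass (g' j) w) (m : ℕ) (S w : ProfiledWord) :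
    mass (poissonLoop x g m S) w ≤ mass (poissonLoop x g' m S) w := by
  induction m generalizing w with
  | zero => exact le_rfl
  | succ m ih =>
    exact mass_bind_mono ih (fun S => mass_bind_mono (fun _ => le_rfl)
      fun q => mass_repeatConcat_mono (h _) q S) w

end Gen

namespace Spec

open Gen (mass)

variable {ι : Type*} (E : ι → Spec ι)

/-- The draws do not depend on `call`, and a sequential composition is monotone in the output masses
of its components. -/
theorem mass_samplerOf_mono {call call' : ι → (ℕ+ → ℝ≥0) → Gen ProfiledWord}
    (h : ∀ i s w, mass (call i s) w ≤ mass (call' i s) w) (A : Spec ι) (s : ℕ+ → ℝ≥0)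
    (w : ProfiledWord) : mass (A.samplerOf E call s) w ≤ mass (A.samplerOf E call' s) w := by
  have hd : ∀ {α : Type} (g : Gen α) (a : α), mass g a ≤ mass g a := fun _ _ => le_rfl
  induction A generalizing s w with
  | neutral => exact le_rfl
  | atom => exact le_rfl
  | var i => exact h i s w
  | sum A B hA hB =>
    refine Gen.mass_bind_mono (hd _) (fun X w => ?_) w
    cases X with
    | true => exact hA s w
    | false => exact hB s w
  | prod A B hA hB =>
    exact Gen.mass_bind_mono (hA s) (fun u => Gen.mass_bind_mono (hB s) fun v => hd _) w
  | diag k A hA => exact Gen.mass_bind_mono (hA _) (fun u => hd _) w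
  | seq A hA =>
    exact Gen.mass_bind_mono (hd _) (fun k => Gen.mass_bind_mono
      (Gen.mass_repeatConcat_mono (hA s) k _) fun S => hd _) w
  | mset A hA =>
    have hg : ∀ (j : ℕ+) (w : ProfiledWord),
        mass (A.samplerOf E call (dilate j s) >>= fun w => pure (w.diag j)) w ≤
        mass (A.samplerOf E call' (dilate j s) >>= fun w => pure (w.diag j)) w :=
      fun j => Gen.mass_bind_mono (hA _) fun u => hd _
    refine Gen.mass_bind_mono (hd _) (fun k w => ?_) w
    split_ifs
    · exact Gen.mass_bind_mono (hd _) (fun k => Gen.mass_bind_mono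
        (Gen.mass_repeatConcat_mono (hA s) k _) fun S => hd _) w
    · exact Gen.mass_bind_mono (Gen.mass_poissonLoop_mono _ hg _ _) (fun S =>
        Gen.mass_bind_mono (hd _) fun q => Gen.mass_bind_mono
          (Gen.mass_repeatConcat_mono (hg k) q _) fun S => hd _) w
  | cyc A hA =>
    refine Gen.mass_bind_mono (hd _) (fun k w => ?_) w
    refine Gen.mass_bind_mono (hd _) (fun l w => ?_) w
    exact Gen.mass_bind_mono (Gen.mass_repeatConcat_mono (hA _) l _) (fun M => hd _) w

theorem mass_callSampler_mono (N : ℕ) (i : ι) (s : ℕ+ → ℝ≥0) (w : ProfiledWord) :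
    mass (callSampler E N i s) w ≤ mass (callSampler E (N + 1) i s) w := by
  induction N generalizing i s w with
  | zero =>
    rw [callSampler, Gen.mass_failure]
    exact zero_le
  | succ N ih => exact mass_samplerOf_mono E ih (E i) s w

end Spec

/-! ### The possible outputs -/

namespace Gen

theorem eq_of_mass_pure_ne_zero {α : Type} {a b : α} (h : mass (pure a : Gen α) b ≠ 0) :
    b = a := by
  classical
  by_contra hne
  rw [mass_pure, if_neg hne] at h
  exact h rfl

theorem exists_of_mass_repeatConcat_ne_zero {g : Gen ProfiledWord} {P : ProfiledWord → Prop}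
    (hg : ∀ w, mass g w ≠ 0 → P w) {q : ℕ} {S w : ProfiledWord}
    (h : mass (repeatConcat g q S) w ≠ 0) :
    ∃ l : List ProfiledWord, l.length = q ∧ (∀ u ∈ l, P u) ∧
      w = l.foldl ProfiledWord.concat S := by
  induction q generalizing S with
  | zero => exact ⟨[], rfl, by simp, eq_of_mass_pure_ne_zero h⟩
  | succ q ih =>
    obtain ⟨u, hu, hw⟩ := mass_bind_ne_zero h
    obtain ⟨l, hl, hP, rfl⟩ := ih hw
    exact ⟨u :: l, by simp [hl], by simpa using ⟨hg u hu, hP⟩, rfl⟩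

theorem exists_of_mass_poissonLoop_ne_zero {x : ℕ+ → ℝ} {g : ℕ+ → Gen ProfiledWord}
    {P : ProfiledWord → Prop} (hg : ∀ j w, mass (g j) w ≠ 0 → P w) {m : ℕ} {S w : ProfiledWord}
    (h : mass (poissonLoop x g m S) w ≠ 0) :
    ∃ l : List ProfiledWord, (∀ u ∈ l, P u) ∧ w = l.foldl ProfiledWord.concat S := by
  induction m generalizing w with
  | zero => exact ⟨[], by simp, eq_of_mass_pure_ne_zero h⟩
  | succ m ih =>
    obtain ⟨u, hu, h⟩ := mass_bind_ne_zero h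
    obtain ⟨q, -, h⟩ := mass_bind_ne_zero h
    obtain ⟨l, hl, rfl⟩ := ih hu
    obtain ⟨l', -, hl', rfl⟩ := exists_of_mass_repeatConcat_ne_zero (hg _) h
    exact ⟨l ++ l', fun u hu => (List.mem_append.1 hu).elim (hl u) (hl' u), by
      rw [List.foldl_append]⟩

end Gen

namespace Spec

open Gen (mass)

variable {ι : Type*} {E : ι → Spec ι}

/-- The sampler only yields a list of diagonals; the list of pairs required by the class is
recovered by choosing an index and an element for each entry. -/
theorem mem_mset_of_foldl {A : Spec ι} {l : List ProfiledWord}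
    (hl : ∀ u ∈ l, ∃ (j : ℕ+) (v : ProfiledWord), Mem E A v ∧ v.diag j = u) :
    Mem E (.mset A) [.brace (l.foldl ProfiledWord.concat [])] := by
  have : ∃ l' : List (ℕ+ × ProfiledWord), (∀ p ∈ l', Mem E A p.2) ∧
      (l'.map fun p => p.2.diag p.1) = l := by
    induction l with
    | nil => exact ⟨[], by simp, rfl⟩
    | cons u l ih =>
      obtain ⟨j, v, hv, rfl⟩ := hl u (by simp)
      obtain ⟨l', h1, h2⟩ := ih fun u hu => hl u (by simp [hu])
      refine ⟨(j, v) :: l', fun p hp => ?_, by rw [List.map_cons, h2]⟩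
      rcases List.mem_cons.1 hp with rfl | hp
      · exact hv
      · exact h1 p hp
  obtain ⟨l', h1, rfl⟩ := this
  exact Mem.mset h1

theorem mem_of_mass_samplerOf_ne_zero {call : ι → (ℕ+ → ℝ≥0) → Gen ProfiledWord}
    (h : ∀ i s w, mass (call i s) w ≠ 0 → Mem E (E i) w) (A : Spec ι) (s : ℕ+ → ℝ≥0)
    (w : ProfiledWord) (hw : mass (A.samplerOf E call s) w ≠ 0) : Mem E A w := by
  induction A generalizing s w with
  | neutral => exact Gen.eq_of_mass_pure_ne_zero hw ▸ Mem.neutral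
  | atom => exact Gen.eq_of_mass_pure_ne_zero hw ▸ Mem.atom
  | var i => exact Mem.var (h i s w hw)
  | sum A B hA hB =>
    obtain ⟨X, -, hw⟩ := Gen.mass_bind_ne_zero hw
    cases X with
    | true => exact Mem.sum_left (hA s w hw)
    | false => exact Mem.sum_right (hB s w hw)
  | prod A B hA hB =>
    obtain ⟨u, hu, hw⟩ := Gen.mass_bind_ne_zero hw
    obtain ⟨v, hv, hw⟩ := Gen.mass_bind_ne_zero hw
    exact Gen.eq_of_mass_pure_ne_zero hw ▸ Mem.prod (hA s u hu) (hB s v hv)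
  | diag k A hA =>
    obtain ⟨u, hu, hw⟩ := Gen.mass_bind_ne_zero hw
    exact Gen.eq_of_mass_pure_ne_zero hw ▸ Mem.diag (hA _ u hu)
  | seq A hA =>
    obtain ⟨k, -, hw⟩ := Gen.mass_bind_ne_zero hw
    obtain ⟨S, hS, hw⟩ := Gen.mass_bind_ne_zero hw
    obtain ⟨l, -, hl, rfl⟩ := Gen.exists_of_mass_repeatConcat_ne_zero (hA s) hS
    exact Gen.eq_of_mass_pure_ne_zero hw ▸ Mem.seq hl
  | mset A hA =>
    have hg : ∀ (j : ℕ+) (w : ProfiledWord),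
        mass (A.samplerOf E call (dilate j s) >>= fun w => pure (w.diag j)) w ≠ 0 →
        ∃ (j : ℕ+) (v : ProfiledWord), Mem E A v ∧ v.diag j = w := by
      intro j w hw
      obtain ⟨v, hv, hw⟩ := Gen.mass_bind_ne_zero hw
      exact ⟨j, v, hA _ v hv, (Gen.eq_of_mass_pure_ne_zero hw).symm⟩
    obtain ⟨k, -, hw⟩ := Gen.mass_bind_ne_zero hw
    split_ifs at hw
    · obtain ⟨q, -, hw⟩ := Gen.mass_bind_ne_zero hw
      obtain ⟨S, hS, hw⟩ := Gen.mass_bind_ne_zero hw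
      obtain ⟨l, -, hl, rfl⟩ := Gen.exists_of_mass_repeatConcat_ne_zero (hA s) hS
      exact Gen.eq_of_mass_pure_ne_zero hw ▸
        mem_mset_of_foldl fun u hu => ⟨1, u, hl u hu, by simp [ProfiledWord.diag]⟩
    · obtain ⟨S, hS, hw⟩ := Gen.mass_bind_ne_zero hw
      obtain ⟨q, -, hw⟩ := Gen.mass_bind_ne_zero hw
      obtain ⟨S', hS', hw⟩ := Gen.mass_bind_ne_zero hw
      obtain ⟨l, hl, rfl⟩ := Gen.exists_of_mass_poissonLoop_ne_zero hg hS
      obtain ⟨l', -, hl', rfl⟩ := Gen.exists_of_mass_repeatConcat_ne_zero (hg k) hS'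
      rw [← List.foldl_append] at hw
      exact Gen.eq_of_mass_pure_ne_zero hw ▸
        mem_mset_of_foldl fun u hu => (List.mem_append.1 hu).elim (hl u) (hl' u)
  | cyc A hA =>
    obtain ⟨k, -, hw⟩ := Gen.mass_bind_ne_zero hw
    obtain ⟨m, -, hw⟩ := Gen.mass_bind_ne_zero hw
    obtain ⟨M, hM, hw⟩ := Gen.mass_bind_ne_zero hw
    obtain ⟨l, hlen, hl, rfl⟩ := Gen.exists_of_mass_repeatConcat_ne_zero (hA _) hM
    refine Gen.eq_of_mass_pure_ne_zero hw ▸ Mem.cyc ?_ hl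
    -- The drawn length is positive, which excludes the empty cycle.
    rintro rfl
    exact m.ne_zero hlen.symm

theorem mem_of_mass_callSampler_ne_zero (N : ℕ) (i : ι) (s : ℕ+ → ℝ≥0) (w : ProfiledWord)
    (hw : mass (callSampler E N i s) w ≠ 0) : Mem E (E i) w := by
  induction N generalizing i s w with
  | zero => exact absurd (Gen.mass_failure w) hw
  | succ N ih => exact mem_of_mass_samplerOf_ne_zero ih (E i) s w hw

/-! ### The law of the output -/

open Classical in
theorem outputProb_eq (A : Spec ι) (s : ℕ+ → ℝ≥0) (N : ℕ) (o : ProfiledObject) :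
    A.outputProb E s N o = ∑' w : ProfiledWord, if w.toObject = o then
      mass (A.samplerOf E (callSampler E N) s) w else 0 := by
  rw [outputProb, PMF.map_apply, ← (Equiv.optionEquivSumPUnit.{0} ProfiledWord).symm.tsum_eq,
    ENNReal.summable.tsum_sum ENNReal.summable]
  simp [mass, eq_comm]

end Spec

end

/-- The samplers of the constructible classes, possibly defined by a system `E` of recursive
equations, are valid Boltzmann samplers for profiled objects, for all nonnegative parameters at
which the generating function converges to a positive number. -/
theorem proposition3p1 {ι : Type*} (E : ι → Spec ι) (A : Spec ι) (s : ℕ+ → ℝ≥0)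
    (hpos : (A.genFun E).eval s ≠ 0) (hconv : (A.genFun E).eval s ≠ ∞) :
    A.IsBoltzmannSampler E s := by
  classical
  set g : ℕ → Gen ProfiledWord := fun N => A.samplerOf E (Spec.callSampler E N) s
  have hmono : ∀ w, Monotone fun N => (g N).mass w := fun w => monotone_nat_of_le_succ fun N =>
    Spec.mass_samplerOf_mono E (Spec.mass_callSampler_mono E N) A s w
  have hmono' : ∀ (P : ProfiledWord → Prop) w, Monotone fun N => if P w then (g N).mass w else 0 := by
    intro P w
    by_cases h : P w
    · simpa only [h, if_true] using hmono w
    · simpa only [h, if_false] using monotone_const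
  have hsup : ∀ P : ProfiledWord → Prop, (∑' w, if P w then ⨆ N, (g N).mass w else 0) =
      ⨆ N, ∑' w, if P w then (g N).mass w else 0 := by
    intro P
    rw [← ENNReal.tsum_iSup_of_monotone (hmono' P)]
    refine tsum_congr fun w => ?_
    by_cases h : P w <;> simp [h]
  have hseries : ∀ N, (A.genFun E).eval s • (g N).series =
      (A.genFunOf (Spec.iterate E N)).scale s := fun N =>
    Spec.eval_smul_series_samplerOf (fun i n => (Spec.isMonoSup_iterate E i).le N n)
      (Spec.eval_smul_series_callSampler N) A s hconv
  have hlim : ProfileSeries.IsMonoSup (fun N => (A.genFunOf (Spec.iterate E N)).scale s)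
      ((A.genFun E).scale s) := (Spec.isMonoSup_genFunOf (Spec.isMonoSup_iterate E) A).scale s
  -- The candidate law collects, for each object, the limit masses of all words that represent it.
  set μ : ProfiledObject → ℝ≥0∞ := fun o =>
    ∑' w : ProfiledWord, if w.toObject = o then ⨆ N, (g N).mass w else 0 with hμ
  have hμsum : ∀ P : ProfiledObject → Prop, (∑' o, if P o then μ o else 0) =
      ⨆ N, ∑' w : ProfiledWord, if P w.toObject then (g N).mass w else 0 := by
    intro P
    rw [← hsup fun w => P w.toObject]
    -- The double sum is arranged so that, after exchanging the sums, each word is counted once, at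
    -- its own object.
    have h1 : ∀ o, (if P o then μ o else 0) = ∑' w : ProfiledWord,
        if o = w.toObject then (if P w.toObject then ⨆ N, (g N).mass w else 0) else 0 := by
      intro o
      by_cases h : P o
      · rw [if_pos h]
        refine tsum_congr fun w => ?_
        by_cases hw : w.toObject = o
        · rw [if_pos hw, if_pos hw.symm, if_pos (hw ▸ h)]
        · rw [if_neg hw, if_neg (Ne.symm hw)]
      · rw [if_neg h, eq_comm, ENNReal.tsum_eq_zero]
        intro w
        by_cases hw : o = w.toObject
        · rw [if_pos hw, if_neg (hw ▸ h)]
        · rw [if_neg hw]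
    simp only [h1]
    rw [ENNReal.tsum_comm]
    simp only [tsum_ite_eq]
  have hone : HasSum μ 1 := by
    have h1 := hμsum fun _ => True
    simp only [if_true, ← Gen.total_series] at h1
    -- Almost sure termination: the masses at finite depth, times F_A(s), increase to the total of
    -- the rescaled F_A, which is F_A(s). Positivity and finiteness then allow cancellation.
    have h2 : (A.genFun E).eval s * ∑' o, μ o = (A.genFun E).eval s := by
      rw [h1, ENNReal.mul_iSup]
      simp only [← ProfileSeries.total_smul, hseries]
      exact hlim.total.symm
    have h3 : ∑' o, μ o = 1 := by
      have := congrArg (fun y => ((A.genFun E).eval s)⁻¹ * y) h2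
      simpa only [← mul_assoc, ENNReal.inv_mul_cancel hpos hconv, one_mul] using this
    exact h3 ▸ ENNReal.summable.hasSum
  obtain ⟨ν, hν⟩ : ∃ ν : PMF ProfiledObject, ∀ o, ν o = μ o := ⟨⟨μ, hone⟩, fun _ => rfl⟩
  refine ⟨ν, fun o => ?_, fun o ho => ?_, fun n => ?_⟩
  · simp only [hν, Spec.outputProb_eq, hμ, hsup]
    exact tendsto_atTop_iSup fun N M hNM => ENNReal.tsum_le_tsum fun w =>
      hmono' (fun w => w.toObject = o) w hNM
  · have h : μ o ≠ 0 := hν o ▸ (PMF.mem_support_iff _ _).1 ho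
    obtain ⟨w, hw⟩ := not_forall.1 (mt ENNReal.tsum_eq_zero.2 h)
    have hwo : w.toObject = o := by
      by_contra hne
      exact hw (if_neg hne)
    rw [if_pos hwo, ENNReal.iSup_eq_zero, not_forall] at hw
    obtain ⟨N, hN⟩ := hw
    exact ⟨w, Spec.mem_of_mass_samplerOf_ne_zero (Spec.mem_of_mass_callSampler_ne_zero N) A s w hN,
      hwo⟩
  · rw [PMF.toOuterMeasure_apply, ENNReal.eq_div_iff hpos hconv]
    -- Summing the law over the objects with profile `n` gives the supremum of the coefficients of
    -- the series at finite depth.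
    have h1 := hμsum fun o => ∀ i, o.partCount i = n i
    simp only [← ProfiledWord.profile_eq_iff, ← Gen.coeff_series] at h1
    have h2 : ∑' o, Set.indicator {o : ProfiledObject | ∀ i, o.partCount i = n i} ν o =
        ⨆ N, MvPowerSeries.coeff n (g N).series := by
      rw [← h1]
      exact tsum_congr fun o => by rw [Set.indicator_apply, hν]; rfl
    rw [h2, ENNReal.mul_iSup]
    simp only [← MvPowerSeries.coeff_smul, hseries]
    exact (hlim.sup n).symm
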